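/- Let $M,N\ge 0$ be integers and let $X_1,\dots,X_M,Y_1,\dots,Y_N$ be independent real random variables with $X_i\sim N(0,\sigma_{X_i}^2)$ and $Y_j\sim N(0,\sigma_{Y_j}^2)$, where all $\sigma_{X_i},\sigma_{Y_j}>0$. Put $\sigma_M=\sigma_{X_1}\cdots\sigma_{X_M}$, $s_N=\sigma_{Y_1}\cdots\sigma_{Y_N}$ and $Z=\dfrac{X_1\cdots X_M}{Y_1\cdots Y_N}$, where empty products are $1$, and let $\varphi_Z(t)=\mathbb{E}[\mathrm{e}^{\mathrm{i}tZ}]$. For $x>0$, the Meijer $G$-function is $$G^{m,n}_{p,q}\bigg(x\,\bigg|\,{a_1,\dots,a_p\atop b_1,\dots,b_q}\bigg)=\frac{1}{2\pi\mathrm{i}}\int_L\frac{\prod_{j=1}^m\Gamma(b_j-s)\prod_{j=1}^n\Gamma(1-a_j+s)}{\prod_{j=n+1}^p\Gamma(a_j-s)\prod_{j=m+1}^q\Gamma(1-b_j+s)}\,x^s\,\mathrm{d}s,$$ where $L$ is an upward vertical line $\operatorname{Re}s=c$ that has the poles of the factors $\Gamma(b_j-s)$, $j\le m$, on its right and the poles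 of the factors $\Gamma(1-a_j+s)$, $j\le n$, on its left; its value at $x=0$ is its limit as $x\downarrow0$. For each of the two $G$-functions below, such a line $L$ exists, for every $x>0$ the integral converges absolutely on every such line with a value that does not depend on the line, and the limit as $x\downarrow 0$ exists. (i) If $M\ge1$ and $N\ge0$, then for all $t\in\mathbb{R}$, $$\varphi_Z(t)=\frac{1}{\pi^{(N+M-1)/2}}\,G^{N+1,M-1}_{M-1,N+1}\bigg(\frac{2^M\sigma_M^2t^2}{2^{N+2}s_N^2}\,\bigg|\,{\frac12,\dots,\frac12\atop 0,\frac12,\dots,\frac12}\bigg),$$ where $\frac12$ occurs $M-1$ times in the upper row and $N$ times in the lower row. (ii) If $M=0$ and $N\ge1$, then for all $t\in\mathbb{R}$, $$\varphi_Z(t)=\frac{1}{\pi^{(N-1)/2}}\,G^{N+1,0}_{0,N+2}\bigg(\frac{t^2}{2^{N+2}s_N^2}\,\bigg|\,{-\atop 0,\frac12,\dots,\frac12}\bigg),$$ where $\frac12$ occurs $N+1$ times in the lower row. -/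

import Mathlib

open MeasureTheory ProbabilityTheory Filter Topology

/-- The integrand of the Mellin-Barnes integral of the Meijer `G`-function `G^{m,n}_{p,q}(x | a; b)`.
Indices start at `0`, so that the first `m` of the `b j` and the first `n` of the `a j` are those
with `j < m` and `j < n`. (`Complex.Gamma` is `0` at its poles and `0⁻¹ = 0`, so that the
denominator is read as the product of the entire functions `1 / Γ`.) -/
noncomputable def meijerIntegrand (m n : ℕ) {p q : ℕ} (a : Fin p → ℂ) (b : Fin q → ℂ)
    (x : ℝ) (s : ℂ) : ℂ :=
  ((∏ j : Fin q with j.val < m, Complex.Gamma (b j - s)) *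
      (∏ j : Fin p with j.val < n, Complex.Gamma (1 - a j + s))) /
    ((∏ j : Fin p with n ≤ j.val, Complex.Gamma (a j - s)) *
      (∏ j : Fin q with m ≤ j.val, Complex.Gamma (1 - b j + s))) * (x : ℂ) ^ s

/-- The upward line `Re s = c` separates the poles `b j + k` of the factors `Γ(b j - s)`, which
lie to its right, from the poles `a j - 1 - k` of the factors `Γ(1 - a j + s)`, which lie to
its left. -/
def MeijerSeparates (m n : ℕ) {p q : ℕ} (a : Fin p → ℂ) (b : Fin q → ℂ) (c : ℝ) : Prop :=
  (∀ j : Fin q, j.val < m → ∀ k : ℕ, c < (b j + k).re) ∧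
    (∀ j : Fin p, j.val < n → ∀ k : ℕ, (a j - 1 - k).re < c)

/-- The contour integral `(1 / 2πi) ∫_L … ds` along the line `L` given by `s = c + i y`, with `y`
running from `-∞` to `∞`, so that `ds = i dy`. -/
noncomputable def meijerLineIntegral (m n : ℕ) {p q : ℕ} (a : Fin p → ℂ) (b : Fin q → ℂ)
    (c x : ℝ) : ℂ :=
  1 / (2 * (Real.pi : ℂ) * Complex.I) *
    ∫ y : ℝ, meijerIntegrand m n a b x ((c : ℂ) + (y : ℂ) * Complex.I) * Complex.I

/-- The Meijer `G`-function `G^{m,n}_{p,q}(x | a; b)` for `x ≥ 0`, for parameters whose two families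
of poles can be separated by a vertical line along which the contour integral converges. For
`x ≠ 0` it is the contour integral along a separating line; at `x = 0`, where `x ^ s` has no
meaning on the contour, it is the limit from the right. -/
noncomputable def meijerG (m n : ℕ) {p q : ℕ} (a : Fin p → ℂ) (b : Fin q → ℂ) (x : ℝ) : ℂ :=
  if x = 0 then
    limUnder (𝓝[>] (0 : ℝ))
      (meijerLineIntegral m n a b (Classical.epsilon (MeijerSeparates m n a b)))
  else meijerLineIntegral m n a b (Classical.epsilon (MeijerSeparates m n a b)) x

/-- No junk value enters `meijerG` on `[0, ∞)`: a separating line exists; for every `x > 0` the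
contour integral converges absolutely on every separating line, and its value, which does not
depend on the line, is `meijerG m n a b x`; the limit that defines the value at `0` exists. -/
def MeijerGWellDefined (m n : ℕ) {p q : ℕ} (a : Fin p → ℂ) (b : Fin q → ℂ) : Prop :=
  (∃ c : ℝ, MeijerSeparates m n a b c) ∧
    (∀ c : ℝ, MeijerSeparates m n a b c → ∀ x : ℝ, 0 < x →
      Integrable (fun y : ℝ => meijerIntegrand m n a b x ((c : ℂ) + (y : ℂ) * Complex.I)) ∧
        meijerLineIntegral m n a b c x = meijerG m n a b x) ∧
    Tendsto (meijerG m n a b) (𝓝[>] (0 : ℝ)) (𝓝 (meijerG m n a b 0))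

/-- The random variable `Z = (X₁ ⋯ X_M) / (Y₁ ⋯ Y_N)`; an empty product is `1`. -/
noncomputable def productRatio {Ω : Type*} {M N : ℕ} (X : Fin M → Ω → ℝ) (Y : Fin N → Ω → ℝ)
    (ω : Ω) : ℝ :=
  (∏ i, X i ω) / ∏ j, Y j ω

/-! Both formulas are Mellin–Barnes integrals: a function of `t` times a random variable is written
as an inverse Mellin transform, expectation and contour integral are exchanged, and the moments that
appear are products of Gamma functions. For a centred Gaussian `V` of variance `τ²`, `E|V|^z =
(2τ²)^(z/2) Γ((z+1)/2) / √π` whenever `Re z > -1` (`integral_abs_cpow_gaussianReal`).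

If `M ≥ 1`, let `R` be the product of all factors of `Z` but one numerator variable, of standard
deviation `σ₀`. Conditioning on `R` gives `φ_Z(t) = E exp(-t²σ₀²R²/2)`. Inserting `exp(-u) = (1/2πi)
∫ Γ(w) u^(-w) dw` leaves `E|R|^(-2w)`, to which each remaining `X_i` contributes `Γ(1/2 - w)` and
each `Y_j` contributes `Γ(1/2 + w)`. With `s = -w` this is the Meijer integrand, and a separating
line is exactly one on which these moments are finite.

If `M = 0`, symmetry gives `φ_Z(t) = E cos(t|Z|)`. The Mellin inversion of the cosine need not
converge absolutely, so `exp(-e^(iθ)u)` with `|θ| < π/2` is used first, and `θ → ±π/2` is taken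
after the expectation, where the rapid decay of the moments of `Z` provides a majorant
(`integral_cexp_neg_rotated`). Replacing `w` by `2w` and applying duplication and reflection turns
`Γ(2w) cos(πw)` into `Γ(w) / Γ(1/2 - w)`.

Both arguments treat `t > 0`; evenness and continuity of `φ_Z` supply the rest. -/

/-! ### The Gamma integral along rays of the right half plane -/

theorem integrableOn_cpow_mul_cexp_neg {s r : ℂ} (hs : 0 < s.re) (hr : 0 < r.re) :
    IntegrableOn (fun t : ℝ => (t : ℂ) ^ (s - 1) * Complex.exp (-r * t)) (Set.Ioi 0) := by
  have h := integrableOn_rpow_mul_exp_neg_mul_rpow (p := 1) (s := s.re - 1) (b := r.re)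
    (by linarith) one_pos hr
  refine h.mono' ?_ ?_
  · refine ContinuousOn.aestronglyMeasurable (fun t ht => ContinuousAt.continuousWithinAt ?_)
      measurableSet_Ioi
    refine ContinuousAt.mul (Complex.continuousAt_ofReal_cpow_const _ _ (Or.inr ht.ne')) ?_
    fun_prop
  · filter_upwards [ae_restrict_mem measurableSet_Ioi] with t ht
    rw [norm_mul, Complex.norm_cpow_eq_rpow_re_of_pos ht, Complex.norm_exp]
    simp

/-- Supplies holomorphy in the rate `r`, for the identity theorem. On the ball of radius `Re r / 2`
the rate keeps real part at least `Re r / 2`, which gives a uniform majorant. -/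
theorem hasDerivAt_integral_cpow_mul_cexp_neg {s r : ℂ} (hs : 0 < s.re) (hr : 0 < r.re) :
    HasDerivAt (fun r : ℂ => ∫ t : ℝ in Set.Ioi 0, (t : ℂ) ^ (s - 1) * Complex.exp (-r * t))
      (∫ t : ℝ in Set.Ioi 0, (t : ℂ) ^ (s - 1) * (Complex.exp (-r * t) * (-t))) r := by
  have hb := integrableOn_rpow_mul_exp_neg_mul_rpow (p := 1) (s := s.re) (b := r.re / 2)
    (by linarith) one_pos (by linarith)
  refine (hasDerivAt_integral_of_dominated_loc_of_deriv_le (μ := volume.restrict (Set.Ioi 0))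
    (F := fun r (t : ℝ) => (t : ℂ) ^ (s - 1) * Complex.exp (-r * t))
    (F' := fun r (t : ℝ) => (t : ℂ) ^ (s - 1) * (Complex.exp (-r * t) * (-t)))
    (bound := fun t => t ^ s.re * Real.exp (-(r.re / 2) * t ^ (1 : ℝ)))
    (Metric.ball_mem_nhds r (half_pos hr)) ?_ (integrableOn_cpow_mul_cexp_neg hs hr) ?_ ?_ hb
    ?_).2
  · refine Filter.Eventually.of_forall fun r => ContinuousOn.aestronglyMeasurable
      (fun t ht => ContinuousAt.continuousWithinAt ?_) measurableSet_Ioi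
    exact (Complex.continuousAt_ofReal_cpow_const _ _ (Or.inr ht.ne')).mul (by fun_prop)
  · refine ContinuousOn.aestronglyMeasurable
      (fun t ht => ContinuousAt.continuousWithinAt ?_) measurableSet_Ioi
    exact (Complex.continuousAt_ofReal_cpow_const _ _ (Or.inr ht.ne')).mul (by fun_prop)
  · filter_upwards [ae_restrict_mem measurableSet_Ioi] with t ht z hz
    have ht' : 0 < t := ht
    have h1 : |(z - r).re| < r.re / 2 :=
      (Complex.abs_re_le_norm _).trans_lt (by simpa [dist_eq_norm] using hz)
    rw [Complex.sub_re, abs_lt] at h1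
    rw [norm_mul, norm_mul, Complex.norm_cpow_eq_rpow_re_of_pos ht, Complex.norm_exp, norm_neg,
      Complex.norm_real, Real.norm_of_nonneg ht'.le, mul_comm (Real.exp _), ← mul_assoc]
    have h2 : t ^ (s - 1).re * t = t ^ s.re := by
      rw [← Real.rpow_add_one ht'.ne']; simp
    rw [h2]
    gcongr
    simp only [Complex.mul_re, Complex.neg_re, Complex.ofReal_re, Complex.neg_im,
      Complex.ofReal_im, mul_zero, sub_zero, Real.rpow_one]
    nlinarith
  · refine Filter.Eventually.of_forall fun t z _ => ?_
    have h : HasDerivAt (fun z : ℂ => -z * (t : ℂ)) (-t) z := by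
      simpa using ((hasDerivAt_id z).neg.mul_const (t : ℂ))
    exact h.cexp.const_mul _

/-- The Gamma integral with a complex rate in the right half plane. -/
theorem integral_cpow_mul_cexp_neg {s r : ℂ} (hs : 0 < s.re) (hr : 0 < r.re) :
    ∫ t : ℝ in Set.Ioi 0, (t : ℂ) ^ (s - 1) * Complex.exp (-r * t) =
      r ^ (-s) * Complex.Gamma s := by
  have hopen : IsOpen {z : ℂ | 0 < z.re} := isOpen_lt continuous_const Complex.continuous_re
  have hL : DifferentiableOn ℂ (fun r : ℂ => ∫ t : ℝ in Set.Ioi 0, (t : ℂ) ^ (s - 1) *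
      Complex.exp (-r * t)) {z : ℂ | 0 < z.re} := fun z hz =>
    (hasDerivAt_integral_cpow_mul_cexp_neg hs hz).differentiableAt.differentiableWithinAt
  have hR : DifferentiableOn ℂ (fun r : ℂ => r ^ (-s) * Complex.Gamma s) {z : ℂ | 0 < z.re} :=
    fun z hz => DifferentiableAt.differentiableWithinAt
      ((differentiableAt_id.cpow_const (Or.inl hz)).mul_const _)
  -- Identity theorem: both sides are analytic in `r` and agree at the real points `1 + 1/(n+1)`,
  -- which accumulate at `1`.
  refine (hL.analyticOnNhd hopen).eqOn_of_preconnected_of_frequently_eq (hR.analyticOnNhd hopen)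
    (convex_halfSpace_re_gt 0).isPreconnected (z₀ := 1) (by simp) ?_ hr
  have ht : Tendsto (fun n : ℕ => (1 : ℂ) + ((1 / ((n : ℝ) + 1) : ℝ) : ℂ)) atTop (𝓝[≠] 1) := by
    refine tendsto_nhdsWithin_iff.2 ⟨?_, Eventually.of_forall fun n => ?_⟩
    · have := (Complex.continuous_ofReal.tendsto _).comp
        (tendsto_one_div_add_atTop_nhds_zero_nat (𝕜 := ℝ))
      simpa using this.const_add (1 : ℂ)
    · have : ((1 / ((n : ℝ) + 1) : ℝ) : ℂ) ≠ 0 :=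
        Complex.ofReal_ne_zero.2 (one_div_pos.2 (by positivity)).ne'
      simpa using this
  refine ht.frequently (Frequently.of_forall fun n => ?_)
  have hp : (0 : ℝ) < 1 + 1 / ((n : ℝ) + 1) := by positivity
  have h := Complex.integral_cpow_mul_exp_neg_mul_Ioi hs hp
  have hc : (1 : ℂ) + ((1 / ((n : ℝ) + 1) : ℝ) : ℂ) = ((1 + 1 / ((n : ℝ) + 1) : ℝ) : ℂ) := by
    push_cast; rfl
  rw [hc, Complex.cpow_neg, ← Complex.inv_cpow _ _ ?_, ← one_div, ← h]
  · simp only [neg_mul]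
  · rw [Complex.arg_ofReal_of_nonneg hp.le]; exact Real.pi_pos.ne

theorem cexp_ofReal_mul_I_cpow {θ : ℝ} (hθ : |θ| < Real.pi) (s : ℂ) :
    Complex.exp (θ * Complex.I) ^ s = Complex.exp (θ * Complex.I * s) := by
  rw [abs_lt] at hθ
  rw [Complex.cpow_def_of_ne_zero (Complex.exp_ne_zero _), Complex.log_exp]
  · simpa using hθ.1
  · simpa using hθ.2.le

theorem cexp_ofReal_mul_I_re_pos {θ : ℝ} (hθ : |θ| < Real.pi / 2) :
    0 < (Complex.exp (θ * Complex.I)).re := by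
  rw [Complex.exp_ofReal_mul_I_re]
  exact Real.cos_pos_of_mem_Ioo (abs_lt.1 hθ)

theorem integral_cpow_mul_cexp_neg_rotated {s : ℂ} (hs : 0 < s.re) {θ : ℝ}
    (hθ : |θ| < Real.pi / 2) :
    ∫ t : ℝ in Set.Ioi 0, (t : ℂ) ^ (s - 1) *
        Complex.exp (-Complex.exp (θ * Complex.I) * t) =
      Complex.exp (-(θ * Complex.I * s)) * Complex.Gamma s := by
  rw [integral_cpow_mul_cexp_neg hs (cexp_ofReal_mul_I_re_pos hθ),
    cexp_ofReal_mul_I_cpow (by linarith [Real.pi_pos]), mul_neg]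

/-! ### Decay of Gamma on vertical lines -/

theorem norm_cexp_neg_mul_I (θ : ℝ) (s : ℂ) :
    ‖Complex.exp (-(θ * Complex.I * s))‖ = Real.exp (θ * s.im) := by
  rw [Complex.norm_exp]; simp

/-- Absolute values are taken inside the rotated Gamma integral, where `Re e^(iθ) = cos θ`; the
phase `e^(-iθs)` on the other side has modulus `e^(θ Im s)`. The sign of `θ` selects the end of the
line on which decay is gained. -/
theorem norm_Gamma_mul_exp_le {s : ℂ} (hs : 0 < s.re) {θ : ℝ} (hθ : |θ| < Real.pi / 2) :
    ‖Complex.Gamma s‖ * Real.exp (θ * s.im) ≤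
      (1 / Real.cos θ) ^ s.re * Real.Gamma s.re := by
  have hcos : 0 < Real.cos θ := Real.cos_pos_of_mem_Ioo (abs_lt.1 hθ)
  rw [← norm_cexp_neg_mul_I, ← norm_mul, mul_comm, ← integral_cpow_mul_cexp_neg_rotated hs hθ,
    ← Real.integral_rpow_mul_exp_neg_mul_Ioi hs hcos]
  refine (norm_integral_le_integral_norm _).trans_eq
    (setIntegral_congr_fun measurableSet_Ioi fun t ht => ?_)
  simp only [norm_mul]
  rw [Complex.norm_cpow_eq_rpow_re_of_pos ht, Complex.norm_exp]
  simp [Complex.exp_ofReal_mul_I_re]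

theorem exists_norm_Gamma_mul_exp_mul_pow_le {θ : ℝ} (hθ : |θ| < Real.pi / 2) (n : ℕ) {σ : ℝ}
    (hσ : 0 < σ) : ∃ C : ℝ, ∀ y : ℝ,
      ‖Complex.Gamma (σ + y * Complex.I)‖ * Real.exp (θ * y) * (1 + |y|) ^ n ≤ C := by
  induction n generalizing σ with
  | zero =>
    refine ⟨(1 / Real.cos θ) ^ σ * Real.Gamma σ, fun y => ?_⟩
    simpa using norm_Gamma_mul_exp_le (s := σ + y * Complex.I) (by simpa) hθ
  | succ n ih =>
    -- One more power of `1 + |y|` is paid for by `Γ(s+1) = s Γ(s)`, since `1 + |y|` is at most a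
    -- constant times `|s|`.
    obtain ⟨C, hC⟩ := ih (σ := σ + 1) (by linarith)
    refine ⟨C * (1 / σ + 1), fun y => ?_⟩
    set s : ℂ := σ + y * Complex.I with hs
    have hre : s.re = σ := by simp [hs]
    have him : s.im = y := by simp [hs]
    have hs0 : s ≠ 0 := fun h => by rw [h] at hre; simp at hre; linarith
    have hn : 0 < ‖s‖ := norm_pos_iff.2 hs0
    have h1 : σ ≤ ‖s‖ := hre ▸ Complex.re_le_norm s
    have h2 : |y| ≤ ‖s‖ := him ▸ Complex.abs_im_le_norm s
    have h3 : 1 + |y| ≤ (1 / σ + 1) * ‖s‖ := by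
      have : 1 ≤ 1 / σ * ‖s‖ := by rw [one_div, inv_mul_eq_div, le_div_iff₀ hσ]; linarith
      linarith
    have h4 := hC y
    have h5 : ((σ + 1 : ℝ) : ℂ) + y * Complex.I = s + 1 := by simp [hs]; ring
    rw [h5, Complex.Gamma_add_one _ hs0, norm_mul] at h4
    calc _ = ‖Complex.Gamma s‖ * Real.exp (θ * y) * (1 + |y|) ^ n * (1 + |y|) := by ring
      _ ≤ ‖Complex.Gamma s‖ * Real.exp (θ * y) * (1 + |y|) ^ n * ((1 / σ + 1) * ‖s‖) := by gcongr
      _ = (‖s‖ * ‖Complex.Gamma s‖ * Real.exp (θ * y) * (1 + |y|) ^ n) * (1 / σ + 1) := by ring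
      _ ≤ _ := by gcongr

theorem continuous_Gamma_vertical {σ : ℝ} (hσ : 0 < σ) :
    Continuous fun y : ℝ => Complex.Gamma (σ + y * Complex.I) := by
  refine continuous_iff_continuousAt.2 fun y => ContinuousAt.comp
    (g := Complex.Gamma) (f := fun y : ℝ => (σ : ℂ) + y * Complex.I) ?_ (by fun_prop)
  refine (Complex.differentiableAt_Gamma _ fun m h => ?_).continuousAt
  have := congrArg Complex.re h
  simp at this
  have : (0 : ℝ) ≤ m := m.cast_nonneg
  linarith

theorem integrable_of_norm_mul_sq_le {E : Type*} [NormedAddCommGroup E] {f : ℝ → E} (hf : AEStronglyMeasurable f) {C : ℝ}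
    (h : ∀ y, ‖f y‖ * (1 + |y|) ^ 2 ≤ C) : Integrable f := by
  refine (integrable_inv_one_add_sq.const_mul C).mono' hf (Eventually.of_forall fun y => ?_)
  rw [← div_eq_mul_inv, le_div_iff₀ (by positivity)]
  refine le_trans ?_ (h y)
  gcongr
  nlinarith [sq_abs y, abs_nonneg y]

theorem integrable_cexp_mul_Gamma_vertical {θ : ℝ} (hθ : |θ| < Real.pi / 2) {σ : ℝ}
    (hσ : 0 < σ) : Integrable fun y : ℝ =>
      Complex.exp (-(θ * Complex.I * (σ + y * Complex.I))) *
        Complex.Gamma (σ + y * Complex.I) := by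
  obtain ⟨C, hC⟩ := exists_norm_Gamma_mul_exp_mul_pow_le hθ 2 hσ
  refine integrable_of_norm_mul_sq_le (C := C) ?_ fun y => ?_
  · exact (Continuous.mul (by fun_prop) (continuous_Gamma_vertical hσ)).aestronglyMeasurable
  · rw [norm_mul, norm_cexp_neg_mul_I, mul_comm (Real.exp _)]
    simpa using hC y

/-- `|Γ(σ + iy)| e^{π|y|/2}` grows at most polynomially in `y`. -/
theorem exists_norm_Gamma_mul_exp_pi_le {σ : ℝ} (hσ : 0 < σ) : ∃ (C : ℝ) (n : ℕ), ∀ y : ℝ,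
    ‖Complex.Gamma (σ + y * Complex.I)‖ * Real.exp (Real.pi / 2 * |y|) ≤ C * (1 + |y|) ^ n := by
  refine ⟨2 ^ ⌈σ⌉₊ * Real.Gamma σ * Real.exp 1, ⌈σ⌉₊, fun y => ?_⟩
  -- The angle `±(π/2 - δ)` depends on `y`: this `δ` costs only `e^(δ|y|) ≤ e` in the exponential,
  -- while `1 / cos θ = 1 / sin δ` grows only linearly in `|y|`.
  set δ : ℝ := 1 / (1 + |y|) with hδ
  have hy := abs_nonneg y
  have hpi := Real.pi_gt_three
  have hδ0 : 0 < δ := by positivity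
  have hδ1 : δ ≤ 1 := by rw [hδ, div_le_one (by positivity)]; linarith
  have hδy : δ * |y| ≤ 1 := by rw [hδ, div_mul_eq_mul_div, div_le_one (by positivity)]; linarith
  obtain ⟨θ, hθ, hθy, hcos⟩ : ∃ θ : ℝ, |θ| < Real.pi / 2 ∧ θ * y = (Real.pi / 2 - δ) * |y| ∧
      Real.cos θ = Real.sin δ := by
    have hlt : |Real.pi / 2 - δ| < Real.pi / 2 := by rw [abs_lt]; constructor <;> linarith
    rcases le_total 0 y with h | h
    · exact ⟨Real.pi / 2 - δ, hlt, by rw [abs_of_nonneg h], Real.cos_pi_div_two_sub _⟩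
    · exact ⟨-(Real.pi / 2 - δ), by rwa [abs_neg], by rw [abs_of_nonpos h]; ring,
        by rw [Real.cos_neg, Real.cos_pi_div_two_sub]⟩
  have h1 := norm_Gamma_mul_exp_le (s := σ + y * Complex.I) (by simpa) hθ
  simp only [Complex.add_re, Complex.ofReal_re, Complex.mul_re, Complex.I_re, mul_zero,
    Complex.ofReal_im, Complex.I_im, mul_one, sub_self, add_zero, Complex.add_im, Complex.mul_im,
    zero_add, hθy, hcos] at h1
  have hsin : 1 / Real.sin δ ≤ 2 * (1 + |y|) := by
    have := Real.mul_le_sin hδ0.le (by linarith)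
    have h3 : δ / 2 ≤ 2 / Real.pi * δ := by
      rw [div_mul_eq_mul_div, div_le_div_iff₀ two_pos Real.pi_pos]
      nlinarith [Real.pi_le_four]
    calc 1 / Real.sin δ ≤ 1 / (δ / 2) := by
          apply one_div_le_one_div_of_le <;> linarith
      _ = 2 * (1 + |y|) := by rw [hδ]; field_simp
  have hsinpos : 0 < Real.sin δ := Real.sin_pos_of_pos_of_lt_pi hδ0 (by linarith)
  have h4 : (1 / Real.sin δ) ^ σ ≤ (2 * (1 + |y|)) ^ ⌈σ⌉₊ := by
    calc (1 / Real.sin δ) ^ σ ≤ (2 * (1 + |y|)) ^ σ :=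
          Real.rpow_le_rpow (by positivity) hsin hσ.le
      _ ≤ (2 * (1 + |y|)) ^ (⌈σ⌉₊ : ℝ) :=
          Real.rpow_le_rpow_of_exponent_le (by linarith) (Nat.le_ceil σ)
      _ = _ := Real.rpow_natCast _ _
  have hexp : Real.exp (Real.pi / 2 * |y|) ≤ Real.exp ((Real.pi / 2 - δ) * |y|) * Real.exp 1 := by
    rw [← Real.exp_add]; gcongr; linarith
  have hG := (Real.Gamma_pos_of_pos hσ).le
  calc _ ≤ ‖Complex.Gamma (σ + y * Complex.I)‖ *
        (Real.exp ((Real.pi / 2 - δ) * |y|) * Real.exp 1) := by gcongr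
    _ = ‖Complex.Gamma (σ + y * Complex.I)‖ * Real.exp ((Real.pi / 2 - δ) * |y|) *
        Real.exp 1 := by ring
    _ ≤ (1 / Real.sin δ) ^ σ * Real.Gamma σ * Real.exp 1 := by gcongr
    _ ≤ (2 * (1 + |y|)) ^ ⌈σ⌉₊ * Real.Gamma σ * Real.exp 1 := by gcongr
    _ = _ := by rw [mul_pow]; ring

/-! ### Mellin inversion of the exponential -/

/-- Cahen-Mellin integral for the exponential along a ray in the right half plane. -/
theorem cexp_neg_eq_integral_Gamma {θ : ℝ} (hθ : |θ| < Real.pi / 2) {σ : ℝ} (hσ : 0 < σ) {u : ℝ}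
    (hu : 0 < u) : Complex.exp (-Complex.exp (θ * Complex.I) * u) =
      1 / (2 * Real.pi) * ∫ y : ℝ, (Complex.exp (-(θ * Complex.I * (σ + y * Complex.I))) *
        Complex.Gamma (σ + y * Complex.I)) * (u : ℂ) ^ (-(σ + y * Complex.I)) := by
  set f : ℝ → ℂ := fun t => Complex.exp (-Complex.exp (θ * Complex.I) * t) with hf
  have hm : ∀ y : ℝ, mellin f (σ + y * Complex.I) =
      Complex.exp (-(θ * Complex.I * (σ + y * Complex.I))) *
        Complex.Gamma (σ + y * Complex.I) := fun y =>
    integral_cpow_mul_cexp_neg_rotated (s := σ + y * Complex.I) (by simpa) hθ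
  have h := mellinInv_mellin_eq σ f hu
    (integrableOn_cpow_mul_cexp_neg (s := σ) (by simpa) (cexp_ofReal_mul_I_re_pos hθ))
    (by
      refine (integrable_cexp_mul_Gamma_vertical hθ hσ).congr (Eventually.of_forall fun y => ?_)
      exact (hm y).symm) (by fun_prop)
  rw [mellinInv] at h
  simp only [hm, smul_eq_mul, Complex.real_smul] at h
  rw [show Complex.exp (-Complex.exp (θ * Complex.I) * u) = f u from rfl, ← h]
  push_cast
  congr 1
  exact integral_congr_ae (Eventually.of_forall fun y => mul_comm _ _)

/-! ### Complex absolute moments of Gaussians -/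

theorem integrable_comp_abs {E : Type*} [NormedAddCommGroup E] {f : ℝ → E}
    (hf : IntegrableOn f (Set.Ioi 0)) : Integrable fun x => f |x| := by
  have hp : IntegrableOn (fun x => f |x|) (Set.Ioi 0) :=
    hf.congr_fun (fun x hx => by rw [abs_of_pos hx]) measurableSet_Ioi
  rw [← integrableOn_univ, ← @Set.Iio_union_Ici _ _ (0 : ℝ), integrableOn_union,
    integrableOn_Ici_iff_integrableOn_Ioi]
  refine ⟨?_, hp⟩
  rw [← (Measure.measurePreserving_neg (volume : Measure ℝ)).integrableOn_comp_preimage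
      (Homeomorph.neg ℝ).measurableEmbedding]
  simpa [Function.comp_def] using hp

theorem integral_comp_abs_eq_two_smul {E : Type*} [NormedAddCommGroup E] [NormedSpace ℝ E]
    {f : ℝ → E} (hf : IntegrableOn f (Set.Ioi 0)) :
    ∫ x, f |x| = (2 : ℝ) • ∫ x in Set.Ioi 0, f x := by
  have h := integrable_comp_abs hf
  have hp : ∫ x in Set.Ioi 0, f |x| = ∫ x in Set.Ioi 0, f x :=
    setIntegral_congr_fun measurableSet_Ioi fun x hx => by rw [abs_of_pos hx]
  have hn : ∫ x in Set.Iic 0, f |x| = ∫ x in Set.Ioi 0, f x := by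
    have := integral_comp_neg_Iic 0 fun x => f |x|
    simp only [abs_neg, neg_zero] at this
    rw [this, hp]
  rw [← intervalIntegral.integral_Iic_add_Ioi h.integrableOn h.integrableOn, hp, hn, two_smul]

theorem integrableOn_cpow_mul_exp_neg_mul_sq {b : ℝ} (hb : 0 < b) {z : ℂ} (hz : -1 < z.re) :
    IntegrableOn (fun x : ℝ => (x : ℂ) ^ z * Complex.exp (-b * ((x ^ (2 : ℝ) : ℝ) : ℂ)))
      (Set.Ioi 0) := by
  refine (integrableOn_rpow_mul_exp_neg_mul_sq hb hz).mono' ?_ ?_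
  · refine ContinuousOn.aestronglyMeasurable (fun t ht => ContinuousAt.continuousWithinAt ?_)
      measurableSet_Ioi
    refine ContinuousAt.mul (Complex.continuousAt_ofReal_cpow_const _ _ (Or.inr ht.ne')) ?_
    simp only [Real.rpow_two]
    fun_prop
  · filter_upwards [ae_restrict_mem measurableSet_Ioi] with t ht
    rw [norm_mul, Complex.norm_cpow_eq_rpow_re_of_pos ht, Complex.norm_exp]
    simp [-Complex.ofReal_pow]

/-- The substitution `t = x²` reduces this to the Gamma integral at `(z+1)/2`; the square is a real
power to match `mellin_comp_rpow`. -/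
theorem integral_cpow_mul_exp_neg_mul_sq {b : ℝ} (hb : 0 < b) {z : ℂ} (hz : -1 < z.re) :
    ∫ x : ℝ in Set.Ioi 0, (x : ℂ) ^ z * Complex.exp (-b * ((x ^ (2 : ℝ) : ℝ) : ℂ)) =
      1 / 2 * ((b : ℂ) ^ (-((z + 1) / 2)) * Complex.Gamma ((z + 1) / 2)) := by
  have h := mellin_comp_rpow (fun t : ℝ => Complex.exp (-b * t)) (z + 1) 2
  have h2 : mellin (fun t : ℝ => Complex.exp (-b * t)) ((z + 1) / 2) =
      (b : ℂ) ^ (-((z + 1) / 2)) * Complex.Gamma ((z + 1) / 2) := by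
    refine integral_cpow_mul_cexp_neg ?_ (by simpa)
    have : ((z + 1) / 2).re = (z.re + 1) / 2 := by simp
    rw [this]; linarith
  simp only [mellin, smul_eq_mul, add_sub_cancel_right] at h h2
  rw [h]
  simp only [Complex.ofReal_ofNat, h2, Complex.real_smul]
  norm_num

theorem integrable_gaussianReal_iff {E : Type*} [NormedAddCommGroup E] [NormedSpace ℝ E]
    {m : ℝ} {v : NNReal} (hv : v ≠ 0) {f : ℝ → E} :
    Integrable f (gaussianReal m v) ↔ Integrable fun x => gaussianPDFReal m v x • f x := by
  rw [gaussianReal_of_var_ne_zero _ hv, integrable_withDensity_iff_integrable_smul'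
    (measurable_gaussianPDF _ _) (ae_of_all _ fun _ => gaussianPDF_lt_top)]
  simp only [toReal_gaussianPDF]

theorem gaussianPDFReal_smul_abs_cpow {τ : ℝ} (hτ : 0 < τ) (z : ℂ) (x : ℝ) :
    gaussianPDFReal 0 (Real.toNNReal (τ ^ 2)) x • ((|x| : ℝ) : ℂ) ^ z =
      (((√(2 * Real.pi * τ ^ 2))⁻¹ : ℝ) : ℂ) * (((|x| : ℝ) : ℂ) ^ z *
        Complex.exp (-((2 * τ ^ 2)⁻¹ : ℝ) * ((|x| ^ (2 : ℝ) : ℝ) : ℂ))) := by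
  rw [gaussianPDFReal, Real.coe_toNNReal _ (by positivity), Complex.real_smul]
  rw [Complex.ofReal_mul, Complex.ofReal_exp]
  have : ((-(x - 0) ^ 2 / (2 * τ ^ 2) : ℝ) : ℂ) =
      -((2 * τ ^ 2)⁻¹ : ℝ) * ((|x| ^ (2 : ℝ) : ℝ) : ℂ) := by
    rw [Real.rpow_two, sq_abs]; push_cast; ring
  rw [this]; ring

theorem toNNReal_sq_ne_zero {τ : ℝ} (hτ : 0 < τ) : Real.toNNReal (τ ^ 2) ≠ 0 :=
  (Real.toNNReal_pos.2 (by positivity)).ne'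

theorem integrable_abs_cpow_gaussianReal {τ : ℝ} (hτ : 0 < τ) {z : ℂ} (hz : -1 < z.re) :
    Integrable (fun x : ℝ => ((|x| : ℝ) : ℂ) ^ z) (gaussianReal 0 (Real.toNNReal (τ ^ 2))) := by
  rw [integrable_gaussianReal_iff (toNNReal_sq_ne_zero hτ)]
  simp only [gaussianPDFReal_smul_abs_cpow hτ]
  exact (integrable_comp_abs
    (integrableOn_cpow_mul_exp_neg_mul_sq (b := (2 * τ ^ 2)⁻¹) (by positivity) hz)).const_mul _

/-- Absolute moments of complex order of a centred Gaussian. -/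
theorem integral_abs_cpow_gaussianReal {τ : ℝ} (hτ : 0 < τ) {z : ℂ} (hz : -1 < z.re) :
    ∫ x : ℝ, ((|x| : ℝ) : ℂ) ^ z ∂(gaussianReal 0 (Real.toNNReal (τ ^ 2))) =
      ((2 * τ ^ 2 : ℝ) : ℂ) ^ (z / 2) * Complex.Gamma ((z + 1) / 2) / (√Real.pi : ℝ) := by
  have hb : 0 < (2 * τ ^ 2)⁻¹ := by positivity
  have h2 : (0 : ℝ) < 2 * τ ^ 2 := by positivity
  rw [integral_gaussianReal_eq_integral_smul (toNNReal_sq_ne_zero hτ)]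
  simp only [gaussianPDFReal_smul_abs_cpow hτ]
  rw [integral_const_mul, integral_comp_abs_eq_two_smul
    (f := fun x : ℝ => (x : ℂ) ^ z * Complex.exp (-((2 * τ ^ 2)⁻¹ : ℝ) *
      ((x ^ (2 : ℝ) : ℝ) : ℂ))) (integrableOn_cpow_mul_exp_neg_mul_sq hb hz),
    integral_cpow_mul_exp_neg_mul_sq hb hz]
  have h3 : (((2 * τ ^ 2)⁻¹ : ℝ) : ℂ) ^ (-((z + 1) / 2)) =
      ((2 * τ ^ 2 : ℝ) : ℂ) ^ (z / 2) * (√(2 * τ ^ 2) : ℝ) := by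
    rw [Complex.ofReal_inv, Complex.cpow_neg, Complex.inv_cpow _ _
      (by rw [Complex.arg_ofReal_of_nonneg h2.le]; exact Real.pi_pos.ne), inv_inv,
      add_div, Complex.cpow_add _ _ (Complex.ofReal_ne_zero.2 h2.ne'), Real.sqrt_eq_rpow,
      Complex.ofReal_cpow h2.le]
    norm_num
  have h4 : √(2 * Real.pi * τ ^ 2) = √Real.pi * √(2 * τ ^ 2) := by
    rw [← Real.sqrt_mul Real.pi_pos.le]; ring_nf
  have h5 : ((√(2 * τ ^ 2) : ℝ) : ℂ) ≠ 0 := Complex.ofReal_ne_zero.2 (Real.sqrt_pos.2 h2).ne'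
  have h6 : ((√Real.pi : ℝ) : ℂ) ≠ 0 :=
    Complex.ofReal_ne_zero.2 (Real.sqrt_pos.2 Real.pi_pos).ne'
  rw [h3, h4, Complex.real_smul, Complex.ofReal_inv, Complex.ofReal_mul (√Real.pi)]
  field_simp
  push_cast
  ring

section

variable {Ω : Type*} [MeasurableSpace Ω] {μ : Measure Ω}

theorem measurable_abs_cpow (z : ℂ) : Measurable fun x : ℝ => ((|x| : ℝ) : ℂ) ^ z := by
  fun_prop

section moments

variable {ι : Type*} [Fintype ι] {V : ι → Ω → ℝ} {τ : ι → ℝ}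

theorem integral_prod_abs_cpow (hτ : ∀ i, 0 < τ i)
    (hV : ∀ i, HasLaw (V i) (gaussianReal 0 (Real.toNNReal (τ i ^ 2))) μ)
    (hind : iIndepFun V μ) {z : ι → ℂ} (hz : ∀ i, -1 < (z i).re) :
    ∫ ω, ∏ i, ((|V i ω| : ℝ) : ℂ) ^ z i ∂μ =
      ∏ i, (((2 * τ i ^ 2 : ℝ) : ℂ) ^ (z i / 2) * Complex.Gamma ((z i + 1) / 2) /
        (√Real.pi : ℝ)) := by
  rw [hind.integral_fun_prod_comp (f := fun i (x : ℝ) => ((|x| : ℝ) : ℂ) ^ z i)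
    (fun i => (hV i).aemeasurable) fun i => (measurable_abs_cpow (z i)).aestronglyMeasurable]
  refine Finset.prod_congr rfl fun i _ => ?_
  rw [← integral_abs_cpow_gaussianReal (hτ i) (hz i)]
  exact (hV i).integral_comp (measurable_abs_cpow (z i)).aestronglyMeasurable

theorem integrable_prod_abs_cpow (hτ : ∀ i, 0 < τ i)
    (hV : ∀ i, HasLaw (V i) (gaussianReal 0 (Real.toNNReal (τ i ^ 2))) μ)
    (hind : iIndepFun V μ) {z : ι → ℂ} (hz : ∀ i, -1 < (z i).re) :
    Integrable (fun ω => ∏ i, ((|V i ω| : ℝ) : ℂ) ^ z i) μ := by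
  have h : Integrable (fun x : ι → ℝ => ∏ i, ((|x i| : ℝ) : ℂ) ^ z i)
      (μ.map fun ω i => V i ω) := by
    rw [hind.map_fun_eq_pi_map fun i => (hV i).aemeasurable]
    have : ∀ i, SigmaFinite (μ.map (V i)) := fun i => by
      rw [(hV i).map_eq]; infer_instance
    refine Integrable.fintype_prod_dep (f := fun i (x : ℝ) => ((|x| : ℝ) : ℂ) ^ z i)
      fun i => ?_
    rw [(hV i).map_eq]
    exact integrable_abs_cpow_gaussianReal (hτ i) (hz i)
  exact h.comp_aemeasurable (aemeasurable_pi_lambda _ fun i => (hV i).aemeasurable)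

theorem ae_ne_zero_of_hasLaw_gaussianReal {U : Ω → ℝ} {m : ℝ} {v : NNReal} (hv : v ≠ 0)
    (hU : HasLaw U (gaussianReal m v) μ) : ∀ᵐ ω ∂μ, U ω ≠ 0 := by
  have := nullSingletonClass_gaussianReal (μ := m) hv
  rw [hU.ae_iff (p := fun x => x ≠ 0) (measurableSet_singleton (0 : ℝ)).compl.mem]
  exact (Set.countable_singleton (0 : ℝ)).ae_notMem _

end moments

/-! ### Expectations through Mellin inversion -/

variable [IsProbabilityMeasure μ]

theorem norm_ofReal_cpow_neg_vertical {u : ℝ} (hu : 0 < u) (σ y : ℝ) :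
    ‖(u : ℂ) ^ (-(σ + y * Complex.I))‖ = u ^ (-σ) := by
  rw [Complex.norm_cpow_eq_rpow_re_of_pos hu]; simp

/-- Expectation of a function that is given by an absolutely convergent Mellin inversion
integral. -/
theorem integral_comp_mellinInv {W : Ω → ℝ} (hW : AEMeasurable W μ) (hpos : ∀ᵐ ω ∂μ, 0 < W ω)
    {σ : ℝ} {G : ℝ → ℂ} (hG : Integrable G) {g : ℝ → ℂ}
    (hg : ∀ u : ℝ, 0 < u → g u =
      1 / (2 * Real.pi) * ∫ y : ℝ, G y * (u : ℂ) ^ (-(σ + y * Complex.I)))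
    (hint : Integrable (fun ω => W ω ^ (-σ)) μ) {x : ℝ} (hx : 0 < x) :
    ∫ ω, g (x * W ω) ∂μ = 1 / (2 * Real.pi) * ∫ y : ℝ, G y *
      ((x : ℂ) ^ (-(σ + y * Complex.I)) * ∫ ω, (W ω : ℂ) ^ (-(σ + y * Complex.I)) ∂μ) := by
  have h1 : ∫ ω, g (x * W ω) ∂μ = ∫ ω, 1 / (2 * Real.pi) * (∫ y : ℝ,
      G y * ((x : ℂ) ^ (-(σ + y * Complex.I)) * (W ω : ℂ) ^ (-(σ + y * Complex.I)))) ∂μ := by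
    refine integral_congr_ae ?_
    filter_upwards [hpos] with ω hω
    rw [hg _ (mul_pos hx hω)]
    simp only [Complex.ofReal_mul, Complex.mul_cpow_ofReal_nonneg hx.le hω.le]
  rw [h1, integral_const_mul, integral_integral_swap]
  · simp only [integral_const_mul]
  -- On the line, `|u^(-w)| = u^(-σ)` does not depend on `y`, so the modulus factors as `x^(-σ)
  -- W^(-σ) ‖G y‖` and Fubini applies.
  · refine ((hint.mul_prod hG.norm).const_mul (x ^ (-σ))).mono ?_ ?_
    · refine AEStronglyMeasurable.mul hG.1.comp_snd (AEMeasurable.aestronglyMeasurable ?_)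
      have : AEMeasurable (fun p : Ω × ℝ => W p.1) (μ.prod volume) := hW.comp_fst
      fun_prop
    · have hp : ∀ᵐ p : Ω × ℝ ∂(μ.prod volume), 0 < W p.1 :=
        Measure.quasiMeasurePreserving_fst.ae hpos
      filter_upwards [hp] with p hp
      simp only [Function.uncurry, norm_mul, norm_norm, norm_ofReal_cpow_neg_vertical hx,
        norm_ofReal_cpow_neg_vertical hp, Real.norm_of_nonneg (Real.rpow_nonneg hx.le _),
        Real.norm_of_nonneg (Real.rpow_nonneg hp.le _)]
      exact le_of_eq (by ring)

/-- Expectation of `exp (-e^{iθ} x W)` as a Mellin-Barnes integral, the limit case `|θ| = π / 2`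
included: there the decay of the moments of `W` replaces that of the exponential factor. -/
theorem integral_cexp_neg_rotated {W : Ω → ℝ} (hW : AEMeasurable W μ)
    (hpos : ∀ᵐ ω ∂μ, 0 < W ω) {σ : ℝ} (hσ : 0 < σ)
    (hint : Integrable (fun ω => W ω ^ (-σ)) μ) {H : ℝ → ℂ} (hHc : Continuous H)
    (hH : ∀ y : ℝ, ∫ ω, (W ω : ℂ) ^ (-(σ + y * Complex.I)) ∂μ = H y)
    (hHd : ∀ n : ℕ, ∃ C : ℝ, ∀ y, ‖H y‖ * (1 + |y|) ^ n ≤ C)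
    {θ : ℝ} (hθ : |θ| ≤ Real.pi / 2) {x : ℝ} (hx : 0 < x) :
    Integrable (fun y : ℝ => (Complex.exp (-(θ * Complex.I * (σ + y * Complex.I))) *
        Complex.Gamma (σ + y * Complex.I)) * ((x : ℂ) ^ (-(σ + y * Complex.I)) * H y)) ∧
    ∫ ω, Complex.exp (-Complex.exp (θ * Complex.I) * ((x * W ω : ℝ) : ℂ)) ∂μ =
      1 / (2 * Real.pi) * ∫ y : ℝ, (Complex.exp (-(θ * Complex.I * (σ + y * Complex.I))) *
        Complex.Gamma (σ + y * Complex.I)) * ((x : ℂ) ^ (-(σ + y * Complex.I)) * H y) := by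
  set K : ℝ → ℝ → ℂ := fun θ y => (Complex.exp (-(θ * Complex.I * (σ + y * Complex.I))) *
        Complex.Gamma (σ + y * Complex.I)) * ((x : ℂ) ^ (-(σ + y * Complex.I)) * H y) with hK
  have hxc : (x : ℂ) ≠ 0 := Complex.ofReal_ne_zero.2 hx.ne'
  have hKc : ∀ θ, Continuous (K θ) := fun θ => by
    refine Continuous.mul (Continuous.mul (by fun_prop) (continuous_Gamma_vertical hσ))
      (Continuous.mul ?_ hHc)
    exact Continuous.const_cpow (by fun_prop) (Or.inl hxc)
  -- A majorant of `K θ` for all `|θ| ≤ π/2` at once, from `e^(θy) ≤ e^(π|y|/2)`.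
  set B : ℝ → ℝ := fun y => ‖Complex.Gamma (σ + y * Complex.I)‖ *
    Real.exp (Real.pi / 2 * |y|) * (x ^ (-σ) * ‖H y‖) with hB
  have hBint : Integrable B := by
    obtain ⟨C, n, hC⟩ := exists_norm_Gamma_mul_exp_pi_le hσ
    -- `n` powers absorb the polynomial growth of the Gamma factor; two more give integrability.
    obtain ⟨D, hD⟩ := hHd (n + 2)
    have hx' := Real.rpow_nonneg hx.le (-σ)
    have hC0 : 0 ≤ C := by
      have := hC 0
      simp only [abs_zero, add_zero, one_pow, mul_one] at this
      exact le_trans (by positivity) this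
    refine integrable_of_norm_mul_sq_le (C := C * (x ^ (-σ) * D)) ?_ fun y => ?_
    · refine Continuous.aestronglyMeasurable ?_
      exact ((continuous_Gamma_vertical hσ).norm.mul (by fun_prop)).mul
        (continuous_const.mul hHc.norm)
    · rw [Real.norm_of_nonneg (by positivity)]
      calc B y * (1 + |y|) ^ 2 ≤ (C * (1 + |y|) ^ n) * (x ^ (-σ) * ‖H y‖) * (1 + |y|) ^ 2 := by
            exact mul_le_mul_of_nonneg_right (mul_le_mul_of_nonneg_right (hC y)
              (by positivity)) (by positivity)
        _ = C * (x ^ (-σ) * (‖H y‖ * (1 + |y|) ^ (n + 2))) := by ring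
        _ ≤ _ := by gcongr; exact hD y
  have hKB : ∀ θ : ℝ, |θ| ≤ Real.pi / 2 → ∀ y, ‖K θ y‖ ≤ B y := fun θ hθ y => by
    simp only [hK, hB, norm_mul, norm_ofReal_cpow_neg_vertical hx, norm_cexp_neg_mul_I]
    rw [mul_comm (Real.exp _)]
    refine mul_le_mul_of_nonneg_right (mul_le_mul_of_nonneg_left (Real.exp_le_exp.2 ?_)
      (norm_nonneg _)) (by positivity)
    simp only [Complex.add_im, Complex.ofReal_im, Complex.mul_im, Complex.ofReal_re,
      Complex.I_im, mul_one, Complex.I_re, mul_zero, add_zero, zero_add]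
    calc θ * y ≤ |θ * y| := le_abs_self _
      _ = |θ| * |y| := abs_mul _ _
      _ ≤ _ := by gcongr
  refine ⟨hBint.mono' (hKc θ).aestronglyMeasurable (Eventually.of_forall (hKB θ hθ)), ?_⟩
  -- Angles strictly inside `(-π/2, π/2)` that tend to `θ`; absolutely convergent inversion is
  -- available for each of them.
  set φ : ℕ → ℝ := fun n => (1 - 1 / ((n : ℝ) + 1)) * θ with hφ
  have hφt : Tendsto φ atTop (𝓝 θ) := by
    have := ((tendsto_one_div_add_atTop_nhds_zero_nat (𝕜 := ℝ)).const_sub 1).mul_const θ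
    simpa only [sub_zero, one_mul] using this
  have hφ' : ∀ n, |φ n| < Real.pi / 2 := fun n => by
    have h0 : (0 : ℝ) < 1 / ((n : ℝ) + 1) := by positivity
    have h1 : 1 / ((n : ℝ) + 1) ≤ 1 := by
      rw [div_le_one (by positivity)]; linarith [(n.cast_nonneg : (0 : ℝ) ≤ n)]
    rw [hφ, abs_mul, abs_of_nonneg (by linarith)]
    nlinarith [abs_nonneg θ, Real.pi_pos]
  have heq : ∀ n, ∫ ω, Complex.exp (-Complex.exp (φ n * Complex.I) * ((x * W ω : ℝ) : ℂ)) ∂μ =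
      1 / (2 * Real.pi) * ∫ y : ℝ, K (φ n) y := fun n => by
    rw [integral_comp_mellinInv hW hpos (integrable_cexp_mul_Gamma_vertical (hφ' n) hσ)
      (g := fun u => Complex.exp (-Complex.exp (φ n * Complex.I) * u))
      (fun u hu => cexp_neg_eq_integral_Gamma (hφ' n) hσ hu) hint hx]
    simp only [hH, hK]
  have hR : Tendsto (fun n => 1 / (2 * (Real.pi : ℂ)) * ∫ y : ℝ, K (φ n) y) atTop
      (𝓝 (1 / (2 * Real.pi) * ∫ y : ℝ, K θ y)) := by
    refine Tendsto.const_mul _ (tendsto_integral_of_dominated_convergence B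
      (fun n => (hKc _).aestronglyMeasurable) hBint
      (fun n => Eventually.of_forall (hKB _ (hφ' n).le)) (Eventually.of_forall fun y => ?_))
    have hc : Continuous fun θ : ℝ => K θ y := by simp only [hK]; fun_prop
    exact (hc.tendsto θ).comp hφt
  have hL : Tendsto (fun n => ∫ ω, Complex.exp (-Complex.exp (φ n * Complex.I) *
      ((x * W ω : ℝ) : ℂ)) ∂μ) atTop
      (𝓝 (∫ ω, Complex.exp (-Complex.exp (θ * Complex.I) * ((x * W ω : ℝ) : ℂ)) ∂μ)) := by
    -- The exponential has modulus at most `1`, because `e^(iφ)` has positive real part and `x W >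
    -- 0`.
    refine tendsto_integral_of_dominated_convergence (fun _ => 1) (fun n => ?_)
      (integrable_const 1) (fun n => ?_) (Eventually.of_forall fun ω => ?_)
    · exact AEMeasurable.aestronglyMeasurable (by fun_prop)
    · filter_upwards [hpos] with ω hω
      rw [Complex.norm_exp, Real.exp_le_one_iff, Complex.re_mul_ofReal, Complex.neg_re]
      have := (cexp_ofReal_mul_I_re_pos (hφ' n)).le
      have h2 := (mul_pos hx hω).le
      nlinarith [mul_nonneg this h2]
    · have hc : Continuous fun θ : ℝ =>
        Complex.exp (-Complex.exp (θ * Complex.I) * ((x * W ω : ℝ) : ℂ)) := by fun_prop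
      exact (hc.tendsto θ).comp hφt
  exact tendsto_nhds_unique hL (hR.congr fun n => (heq n).symm)

end

/-! ### Complex powers of nonnegative reals -/

theorem ofReal_prod_cpow {ι : Type*} (S : Finset ι) {a : ι → ℝ} (ha : ∀ i ∈ S, 0 ≤ a i) (w : ℂ) :
    ((∏ i ∈ S, a i : ℝ) : ℂ) ^ w = ∏ i ∈ S, (a i : ℂ) ^ w := by
  classical
  induction S using Finset.induction_on with
  | empty => simp
  | insert i S hi ih =>
    rw [Finset.prod_insert hi, Finset.prod_insert hi, Complex.ofReal_mul,
      Complex.mul_cpow_ofReal_nonneg (ha i (Finset.mem_insert_self _ _))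
        (Finset.prod_nonneg fun j hj => ha j (Finset.mem_insert_of_mem hj)),
      ih fun j hj => ha j (Finset.mem_insert_of_mem hj)]

theorem ofReal_sq_cpow {r : ℝ} (hr : r ≠ 0) (w : ℂ) :
    ((r ^ 2 : ℝ) : ℂ) ^ w = ((|r| : ℝ) : ℂ) ^ (2 * w) := by
  rw [← sq_abs, sq, Complex.ofReal_mul,
    Complex.mul_cpow_ofReal_nonneg (abs_nonneg r) (abs_nonneg r), two_mul,
    Complex.cpow_add _ _ (Complex.ofReal_ne_zero.2 (abs_ne_zero.2 hr))]

theorem ofReal_inv_cpow {r : ℝ} (hr : 0 ≤ r) (w : ℂ) :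
    ((r⁻¹ : ℝ) : ℂ) ^ w = (r : ℂ) ^ (-w) := by
  rw [Complex.ofReal_inv, Complex.cpow_neg, Complex.inv_cpow]
  rw [Complex.arg_ofReal_of_nonneg hr]
  exact Real.pi_pos.ne

/-! ### Conditioning, symmetry and continuity of the characteristic function -/

section

variable {Ω : Type*} [MeasurableSpace Ω] {μ : Measure Ω} [IsProbabilityMeasure μ]

/-- Fubini on the joint law: for fixed `R`, integrating out `U` gives the Gaussian characteristic
function at `t R`. -/
theorem integral_cexp_mul_gaussian {U R : Ω → ℝ} {v : NNReal}
    (hU : HasLaw U (gaussianReal 0 v) μ) (hR : AEMeasurable R μ) (hUR : IndepFun U R μ) (t : ℝ) :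
    ∫ ω, Complex.exp (Complex.I * t * ((U ω * R ω : ℝ) : ℂ)) ∂μ =
      ∫ ω, Complex.exp (-((t ^ 2 * v / 2 * R ω ^ 2 : ℝ) : ℂ)) ∂μ := by
  have hmap := (indepFun_iff_map_prod_eq_prod_map_map hU.aemeasurable hR).1 hUR
  rw [hU.map_eq] at hmap
  have : IsProbabilityMeasure (μ.map R) := Measure.isProbabilityMeasure_map hR
  set f : ℝ × ℝ → ℂ := fun p => Complex.exp (Complex.I * t * ((p.1 * p.2 : ℝ) : ℂ)) with hf
  have hfm : Measurable f := by fun_prop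
  have h1 : ∫ ω, f (U ω, R ω) ∂μ = ∫ p, f p ∂(μ.map fun ω => (U ω, R ω)) :=
    (integral_map (hU.aemeasurable.prodMk hR) hfm.aestronglyMeasurable).symm
  have hfi : Integrable f ((gaussianReal 0 v).prod (μ.map R)) := by
    refine (integrable_const (1 : ℝ)).mono' hfm.aestronglyMeasurable
      (Eventually.of_forall fun p => ?_)
    simp [hf, Complex.norm_exp]
  change ∫ ω, f (U ω, R ω) ∂μ = _
  rw [h1, hmap, integral_prod_symm _ hfi]
  rw [integral_map hR]
  · refine integral_congr_ae (Eventually.of_forall fun ω => ?_)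
    have h2 := charFun_gaussianReal (μ := 0) (v := v) (t * R ω)
    rw [charFun_apply_real] at h2
    simp only [hf]
    convert h2 using 1
    · refine integral_congr_ae (Eventually.of_forall fun x => ?_)
      simp only
      congr 1; push_cast; ring
    · congr 1; push_cast; ring
  · exact (hfm.stronglyMeasurable.integral_prod_left').aestronglyMeasurable

/-- By independence `(U, R)` and `(-U, R)` have the same joint law. -/
theorem integral_cexp_neg_of_identDistrib_neg {U R : Ω → ℝ} (hU : IdentDistrib U (fun ω => -U ω) μ μ)
    (hR : AEMeasurable R μ) (hUR : IndepFun U R μ) (t : ℝ) :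
    ∫ ω, Complex.exp (Complex.I * t * ((U ω * R ω : ℝ) : ℂ)) ∂μ =
      ∫ ω, Complex.exp (-(Complex.I * t * ((U ω * R ω : ℝ) : ℂ))) ∂μ := by
  have h1 := (indepFun_iff_map_prod_eq_prod_map_map hU.aemeasurable_fst hR).1 hUR
  have hUR' : IndepFun (fun ω => -U ω) R μ := hUR.comp measurable_neg measurable_id
  have h2 := (indepFun_iff_map_prod_eq_prod_map_map hU.aemeasurable_snd hR).1 hUR'
  rw [← hU.map_eq, ← h1] at h2
  set f : ℝ × ℝ → ℂ := fun p => Complex.exp (Complex.I * t * ((p.1 * p.2 : ℝ) : ℂ)) with hf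
  have hfm : Measurable f := by fun_prop
  calc _ = ∫ p, f p ∂(μ.map fun ω => (U ω, R ω)) :=
        (integral_map (hU.aemeasurable_fst.prodMk hR) hfm.aestronglyMeasurable).symm
    _ = ∫ ω, f (-U ω, R ω) ∂μ := by
        rw [← h2]
        exact integral_map (hU.aemeasurable_snd.prodMk hR) hfm.aestronglyMeasurable
    _ = _ := by
        refine integral_congr_ae (Eventually.of_forall fun ω => ?_)
        simp only [hf]
        congr 1; push_cast; ring

theorem continuous_integral_cexp_mul {Z : Ω → ℝ} (hZ : AEMeasurable Z μ) :
    Continuous fun t : ℝ => ∫ ω, Complex.exp (Complex.I * t * (Z ω : ℂ)) ∂μ := by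
  refine continuous_of_dominated (bound := fun _ => 1) (fun t => ?_) (fun t => ?_)
    (integrable_const 1) ?_
  · exact AEMeasurable.aestronglyMeasurable (by fun_prop)
  · exact Eventually.of_forall fun ω => by simp [Complex.norm_exp]
  · exact Eventually.of_forall fun ω => by fun_prop

end

/-! ### The factors of the ratio -/

/-- The independent factors of `productRatio`. -/
noncomputable def ratioFactor {Ω : Type*} {M N : ℕ} (X : Fin M → Ω → ℝ) (Y : Fin N → Ω → ℝ) :
    Fin M ⊕ Fin N → Ω → ℝ :=
  Sum.elim X fun j ω => (Y j ω)⁻¹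

section

variable {Ω : Type*} {M N : ℕ} {X : Fin M → Ω → ℝ} {Y : Fin N → Ω → ℝ}

theorem productRatio_eq_prod_ratioFactor (ω : Ω) :
    productRatio X Y ω = ∏ i, ratioFactor X Y i ω := by
  simp [productRatio, ratioFactor, Fintype.prod_sum_type, div_eq_mul_inv]

theorem productRatio_eq_mul (i₀ : Fin M ⊕ Fin N) (ω : Ω) : productRatio X Y ω =
    ratioFactor X Y i₀ ω * ∏ i ∈ Finset.univ.erase i₀, ratioFactor X Y i ω := by
  rw [productRatio_eq_prod_ratioFactor,
    Finset.mul_prod_erase _ (fun i => ratioFactor X Y i ω) (Finset.mem_univ i₀)]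

/-- The exponents that turn absolute moments of the underlying variables into moments of the
product of their ratio factors. -/
def ratioSign {M N : ℕ} : Fin M ⊕ Fin N → ℂ :=
  Sum.elim (fun _ => 1) fun _ => -1

theorem abs_ratioFactor_cpow (i : Fin M ⊕ Fin N) (ω : Ω) (w : ℂ) :
    ((|ratioFactor X Y i ω| : ℝ) : ℂ) ^ w =
      ((|Sum.elim X Y i ω| : ℝ) : ℂ) ^ (ratioSign i * w) := by
  rcases i with i | j
  · simp [ratioFactor, ratioSign]
  · simp only [ratioFactor, ratioSign, Sum.elim_inr, abs_inv, neg_mul, one_mul]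
    exact ofReal_inv_cpow (abs_nonneg _) w

/-- Factors outside `S` get exponent `0`, so that partial products are also covered by the moment
formula for the full independent family. -/
theorem abs_prod_ratioFactor_cpow (S : Finset (Fin M ⊕ Fin N)) (ω : Ω) (w : ℂ) :
    ((|∏ i ∈ S, ratioFactor X Y i ω| : ℝ) : ℂ) ^ w =
      ∏ i, ((|Sum.elim X Y i ω| : ℝ) : ℂ) ^ (if i ∈ S then ratioSign i * w else 0) := by
  rw [Finset.abs_prod, ofReal_prod_cpow _ fun i _ => abs_nonneg _,
    ← Finset.prod_subset (Finset.subset_univ S)]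
  · exact Finset.prod_congr rfl fun i hi => by rw [if_pos hi, abs_ratioFactor_cpow]
  · intro i _ hi
    rw [if_neg hi, Complex.cpow_zero]

end

section

variable {Ω : Type*} [MeasurableSpace Ω] {μ : Measure Ω} {M N : ℕ} {X : Fin M → Ω → ℝ}
  {Y : Fin N → Ω → ℝ}

theorem iIndepFun_ratioFactor (hindep : iIndepFun (Sum.elim X Y) μ) :
    iIndepFun (ratioFactor X Y) μ := by
  have h := hindep.comp (Sum.elim (fun _ => id) fun _ x => x⁻¹) (by
    rintro (i | j)
    · exact measurable_id
    · exact measurable_inv)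
  convert h using 1
  funext i
  rcases i with i | j <;> rfl

theorem aemeasurable_ratioFactor (hV : ∀ i, AEMeasurable (Sum.elim X Y i) μ) (i : Fin M ⊕ Fin N) :
    AEMeasurable (ratioFactor X Y i) μ := by
  rcases i with i | j
  · exact hV (Sum.inl i)
  · exact (hV (Sum.inr j)).inv

theorem indepFun_ratioFactor (hV : ∀ i, AEMeasurable (Sum.elim X Y i) μ)
    (hindep : iIndepFun (Sum.elim X Y) μ) (i₀ : Fin M ⊕ Fin N) :
    IndepFun (ratioFactor X Y i₀)
      (fun ω => ∏ i ∈ Finset.univ.erase i₀, ratioFactor X Y i ω) μ := by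
  have h := (iIndepFun_ratioFactor hindep).indepFun_finsetProd_of_notMem₀
    (aemeasurable_ratioFactor hV) (Finset.notMem_erase i₀ Finset.univ)
  convert h.symm using 1
  funext ω
  simp

theorem identDistrib_ratioFactor_neg {v : Fin M ⊕ Fin N → NNReal}
    (hV : ∀ i, HasLaw (Sum.elim X Y i) (gaussianReal 0 (v i)) μ) (i : Fin M ⊕ Fin N) :
    IdentDistrib (ratioFactor X Y i) (fun ω => -ratioFactor X Y i ω) μ μ := by
  have hI : ∀ i, IdentDistrib (Sum.elim X Y i) (-Sum.elim X Y i) μ μ := fun i => by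
    have h := gaussianReal_neg (hV i)
    rw [neg_zero] at h
    exact ⟨(hV i).aemeasurable, h.aemeasurable, (hV i).map_eq.trans h.map_eq.symm⟩
  rcases i with i | j
  · exact hI (Sum.inl i)
  · have := (hI (Sum.inr j)).comp measurable_inv
    have hneg : (fun ω => -ratioFactor X Y (Sum.inr j) ω) =
        Inv.inv ∘ (-Sum.elim X Y (Sum.inr j)) :=
      funext fun ω => by simp [ratioFactor, inv_neg]
    rw [hneg]
    exact this

theorem integral_cexp_productRatio_neg [IsProbabilityMeasure μ] {v : Fin M ⊕ Fin N → NNReal}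
    (hV : ∀ i, HasLaw (Sum.elim X Y i) (gaussianReal 0 (v i)) μ)
    (hindep : iIndepFun (Sum.elim X Y) μ) (i₀ : Fin M ⊕ Fin N) (t : ℝ) :
    ∫ ω, Complex.exp (Complex.I * t * (productRatio X Y ω : ℂ)) ∂μ =
      ∫ ω, Complex.exp (-(Complex.I * t * (productRatio X Y ω : ℂ))) ∂μ := by
  have hm := fun i => (hV i).aemeasurable
  simp only [productRatio_eq_mul i₀]
  refine integral_cexp_neg_of_identDistrib_neg (identDistrib_ratioFactor_neg hV i₀) ?_
    (indepFun_ratioFactor hm hindep i₀) t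
  exact Finset.aemeasurable_fun_prod _ fun i _ => aemeasurable_ratioFactor hm i

theorem aemeasurable_productRatio (hV : ∀ i, AEMeasurable (Sum.elim X Y i) μ) :
    AEMeasurable (productRatio X Y) μ := by
  have : productRatio X Y = fun ω => ∏ i, ratioFactor X Y i ω :=
    funext fun ω => productRatio_eq_prod_ratioFactor ω
  rw [this]
  exact Finset.aemeasurable_fun_prod _ fun i _ => aemeasurable_ratioFactor hV i

theorem ae_prod_ratioFactor_ne_zero {v : Fin M ⊕ Fin N → NNReal} (hv : ∀ i, v i ≠ 0)
    (hV : ∀ i, HasLaw (Sum.elim X Y i) (gaussianReal 0 (v i)) μ) (S : Finset (Fin M ⊕ Fin N)) :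
    ∀ᵐ ω ∂μ, ∏ i ∈ S, ratioFactor X Y i ω ≠ 0 := by
  have h : ∀ᵐ ω ∂μ, ∀ i, Sum.elim X Y i ω ≠ 0 :=
    ae_all_iff.2 fun i => ae_ne_zero_of_hasLaw_gaussianReal (hv i) (hV i)
  filter_upwards [h] with ω hω
  refine Finset.prod_ne_zero_iff.2 fun i _ => ?_
  rcases i with i | j
  · exact hω (Sum.inl i)
  · exact inv_ne_zero (hω (Sum.inr j))

end

/-! ### The Meijer integrals as inverse Mellin integrals -/

/-- The reflection `s = -w` puts the line at `Re w = -c`, the form that Mellin inversion produces.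
-/
theorem meijerLineIntegral_eq (m n : ℕ) {p q : ℕ} (a : Fin p → ℂ) (b : Fin q → ℂ) (c x : ℝ) :
    meijerLineIntegral m n a b c x = 1 / (2 * Real.pi) *
      ∫ y : ℝ, meijerIntegrand m n a b x (-(((-c : ℝ) : ℂ) + y * Complex.I)) := by
  rw [meijerLineIntegral, integral_mul_const, ← integral_neg_eq_self]
  have hpi : (Real.pi : ℂ) ≠ 0 := Complex.ofReal_ne_zero.2 Real.pi_ne_zero
  have hI := Complex.I_ne_zero
  field_simp
  congr 2
  funext y
  congr 1
  push_cast
  ring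

theorem integrable_meijerIntegrand_of_neg {m n p q : ℕ} {a : Fin p → ℂ} {b : Fin q → ℂ}
    {c x : ℝ} (h : Integrable fun y : ℝ =>
      meijerIntegrand m n a b x (-(((-c : ℝ) : ℂ) + y * Complex.I))) :
    Integrable fun y : ℝ => meijerIntegrand m n a b x ((c : ℂ) + (y : ℂ) * Complex.I) := by
  refine h.comp_neg.congr (Eventually.of_forall fun y => ?_)
  simp only
  congr 1
  push_cast
  ring

/-- No contour shift is needed: the value is the same on all separating lines because on each of
them it equals `F x`. This also makes the line chosen by `Classical.epsilon` immaterial. -/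
theorem meijerGWellDefined_of_eq {m n p q : ℕ} {a : Fin p → ℂ} {b : Fin q → ℂ} {F : ℝ → ℂ}
    (hex : ∃ c, MeijerSeparates m n a b c)
    (h : ∀ c, MeijerSeparates m n a b c → ∀ x : ℝ, 0 < x →
      Integrable (fun y : ℝ => meijerIntegrand m n a b x ((c : ℂ) + (y : ℂ) * Complex.I)) ∧
        meijerLineIntegral m n a b c x = F x)
    (hF : Tendsto F (𝓝[>] 0) (𝓝 (F 0))) :
    MeijerGWellDefined m n a b ∧ ∀ x, 0 ≤ x → meijerG m n a b x = F x := by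
  have hε : MeijerSeparates m n a b (Classical.epsilon (MeijerSeparates m n a b)) :=
    Classical.epsilon_spec hex
  have hpos : ∀ x, 0 < x → meijerG m n a b x = F x := fun x hx => by
    rw [meijerG, if_neg hx.ne']
    exact (h _ hε x hx).2
  have hzero : meijerG m n a b 0 = F 0 := by
    rw [meijerG, if_pos rfl]
    refine Tendsto.limUnder_eq (hF.congr' ?_)
    filter_upwards [self_mem_nhdsWithin] with x hx
    exact (h _ hε x hx).2.symm
  refine ⟨⟨hex, fun c hc x hx => ⟨(h c hc x hx).1, (h c hc x hx).2.trans (hpos x hx).symm⟩, ?_⟩,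
    fun x hx => ?_⟩
  · rw [hzero]
    refine hF.congr' ?_
    filter_upwards [self_mem_nhdsWithin] with x hx
    exact (hpos x hx).symm
  · rcases hx.eq_or_lt with rfl | hx
    · exact hzero
    · exact hpos x hx

theorem meijerIntegrand_full (n N : ℕ) (x : ℝ) (w : ℂ) :
    meijerIntegrand (N + 1) n (fun _ : Fin n => (1 / 2 : ℂ))
        (Matrix.vecCons (0 : ℂ) (fun _ : Fin N => (1 / 2 : ℂ))) x (-w) =
      Complex.Gamma w * Complex.Gamma (1 / 2 + w) ^ N * Complex.Gamma (1 / 2 - w) ^ n *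
        (x : ℂ) ^ (-w) := by
  have h1 : (Finset.univ.filter fun j : Fin (N + 1) => j.val < N + 1) = Finset.univ :=
    Finset.filter_true_of_mem fun j _ => j.isLt
  have h2 : (Finset.univ.filter fun j : Fin n => j.val < n) = Finset.univ :=
    Finset.filter_true_of_mem fun j _ => j.isLt
  have h3 : (Finset.univ.filter fun j : Fin (N + 1) => N + 1 ≤ j.val) = ∅ :=
    Finset.filter_false_of_mem fun j _ => not_le.2 j.isLt
  have h4 : (Finset.univ.filter fun j : Fin n => n ≤ j.val) = ∅ :=
    Finset.filter_false_of_mem fun j _ => not_le.2 j.isLt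
  rw [meijerIntegrand, h1, h2, h3, h4, Finset.prod_empty, Finset.prod_empty]
  simp only [Fin.prod_univ_succ, Matrix.cons_val_zero, Matrix.cons_val_succ, Finset.prod_const,
    Finset.card_univ, Fintype.card_fin, mul_one, div_one,
    show (1 : ℂ) - 1 / 2 + -w = 1 / 2 - w by ring, sub_neg_eq_add, zero_add]

theorem prod_filter_val_lt_last {n : ℕ} (f : Fin (n + 1) → ℂ) :
    ∏ j : Fin (n + 1) with j.val < n, f j = ∏ j : Fin n, f j.castSucc := by
  rw [Finset.prod_filter, Fin.prod_univ_castSucc]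
  simp

theorem prod_filter_last_le_val {n : ℕ} (f : Fin (n + 1) → ℂ) :
    ∏ j : Fin (n + 1) with n ≤ j.val, f j = f (Fin.last n) := by
  rw [Finset.prod_filter, Fin.prod_univ_castSucc, Finset.prod_eq_one]
  · simp
  · exact fun j _ => if_neg (not_le.2 j.isLt)

theorem meijerIntegrand_drop_last (N : ℕ) (x : ℝ) (w : ℂ) :
    meijerIntegrand (N + 1) 0 (Fin.elim0 : Fin 0 → ℂ)
        (Matrix.vecCons (0 : ℂ) (fun _ : Fin (N + 1) => (1 / 2 : ℂ))) x (-w) =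
      Complex.Gamma w * Complex.Gamma (1 / 2 + w) ^ N / Complex.Gamma (1 / 2 - w) *
        (x : ℂ) ^ (-w) := by
  rw [meijerIntegrand, prod_filter_val_lt_last, prod_filter_last_le_val, Fin.prod_univ_succ,
    ← Fin.succ_last]
  simp only [Finset.prod_filter, Finset.univ_eq_empty, Finset.prod_empty, mul_one, one_mul,
    Fin.castSucc_zero, Fin.castSucc_succ, Matrix.cons_val_zero, Matrix.cons_val_succ,
    Finset.prod_const, Finset.card_univ, Fintype.card_fin, zero_add, sub_neg_eq_add,
    show (1 : ℂ) - 1 / 2 + -w = 1 / 2 - w by ring]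

/-- Only the extreme poles matter: `0` on the right and `1/2 - 1` on the left, the latter present
only when there is an upper parameter. -/
theorem meijerSeparates_full_iff (n N : ℕ) (c : ℝ) :
    MeijerSeparates (N + 1) n (fun _ : Fin n => (1 / 2 : ℂ))
        (Matrix.vecCons (0 : ℂ) (fun _ : Fin N => (1 / 2 : ℂ))) c ↔
      c < 0 ∧ (n ≠ 0 → -1 / 2 < c) := by
  constructor
  · rintro ⟨h1, h2⟩
    refine ⟨by simpa using h1 0 (Nat.succ_pos _) 0, fun hn => ?_⟩
    have := h2 ⟨0, Nat.pos_of_ne_zero hn⟩ (Nat.pos_of_ne_zero hn) 0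
    norm_num at this
    linarith
  · rintro ⟨h1, h2⟩
    refine ⟨fun j _ k => ?_, fun j _ k => ?_⟩
    · have hk : (0 : ℝ) ≤ k := k.cast_nonneg
      refine Fin.cases ?_ (fun j => ?_) j
      · simp; linarith
      · simp; linarith
    · have hk : (0 : ℝ) ≤ k := k.cast_nonneg
      have := h2 (by have := j.isLt; omega)
      norm_num
      linarith

theorem meijerSeparates_drop_last_iff (N : ℕ) (c : ℝ) :
    MeijerSeparates (N + 1) 0 (Fin.elim0 : Fin 0 → ℂ)
        (Matrix.vecCons (0 : ℂ) (fun _ : Fin (N + 1) => (1 / 2 : ℂ))) c ↔ c < 0 := by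
  constructor
  · rintro ⟨h1, -⟩
    simpa using h1 0 (Nat.succ_pos _) 0
  · intro h
    refine ⟨fun j _ k => ?_, fun j => j.elim0⟩
    have hk : (0 : ℝ) ≤ k := k.cast_nonneg
    refine Fin.cases ?_ (fun j => ?_) j
    · simp; linarith
    · simp; linarith

/-- Applied with `F x = C⁻¹ φ(√(x/κ))`: continuity of `φ` gives the limit at `0`, and evenness gives
negative `t`. -/
theorem meijerGWellDefined_of_eq_mul {m n p q : ℕ} {a : Fin p → ℂ} {b : Fin q → ℂ} {φ : ℝ → ℂ}
    {C : ℂ} (hC : C ≠ 0) {κ : ℝ} (hκ : 0 < κ) (hφ : Continuous φ) (heven : ∀ t, φ (-t) = φ t)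
    (hex : ∃ c, MeijerSeparates m n a b c)
    (h : ∀ c, MeijerSeparates m n a b c → ∀ t : ℝ, 0 < t →
      Integrable (fun y : ℝ =>
        meijerIntegrand m n a b (κ * t ^ 2) ((c : ℂ) + (y : ℂ) * Complex.I)) ∧
        φ t = C * meijerLineIntegral m n a b c (κ * t ^ 2)) :
    MeijerGWellDefined m n a b ∧ ∀ t, φ t = C * meijerG m n a b (κ * t ^ 2) := by
  have key := meijerGWellDefined_of_eq (F := fun x => C⁻¹ * φ (√(x / κ))) hex
    (fun c hc x hx => by
      have ht : 0 < √(x / κ) := Real.sqrt_pos.2 (by positivity)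
      have hxt : κ * √(x / κ) ^ 2 = x := by
        rw [Real.sq_sqrt (by positivity)]; field_simp
      obtain ⟨h1, h2⟩ := h c hc _ ht
      rw [hxt] at h1 h2
      exact ⟨h1, by simp only [h2, inv_mul_cancel_left₀ hC]⟩)
    (by
      have : Continuous fun x : ℝ => C⁻¹ * φ (√(x / κ)) := by fun_prop
      exact (this.tendsto 0).mono_left nhdsWithin_le_nhds)
  refine ⟨key.1, fun t => ?_⟩
  rw [key.2 _ (by positivity), mul_inv_cancel_left₀ hC, mul_div_cancel_left₀ _ hκ.ne',
    Real.sqrt_sq_eq_abs]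
  rcases abs_choice t with h | h
  · rw [h]
  · rw [h, heven]

theorem sqrt_pi_pow (k : ℕ) : √Real.pi ^ k = Real.pi ^ ((k : ℝ) / 2) := by
  rw [Real.sqrt_eq_rpow, ← Real.rpow_natCast, ← Real.rpow_mul Real.pi_pos.le]
  congr 1
  ring

theorem integrable_rpow_of_cpow {Ω : Type*} [MeasurableSpace Ω] {μ : Measure Ω} {W : Ω → ℝ}
    (hpos : ∀ᵐ ω ∂μ, 0 < W ω) {σ : ℝ}
    (h : Integrable (fun ω => (W ω : ℂ) ^ (-(σ + (0 : ℝ) * Complex.I))) μ) :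
    Integrable (fun ω => W ω ^ (-σ)) μ := by
  refine h.norm.congr ?_
  filter_upwards [hpos] with ω hω
  exact norm_ofReal_cpow_neg_vertical hω σ 0

/-- `Γ(w)` alone is integrable on the line, and all other factors are bounded there. -/
theorem integrable_meijerIntegrand_full {n : ℕ} (N : ℕ) {c : ℝ} (hc : c < 0)
    (hcn : n ≠ 0 → -1 / 2 < c) {x : ℝ} (hx : 0 < x) :
    Integrable fun y : ℝ => meijerIntegrand (N + 1) n (fun _ : Fin n => (1 / 2 : ℂ))
      (Matrix.vecCons (0 : ℂ) (fun _ : Fin N => (1 / 2 : ℂ))) x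
      ((c : ℂ) + (y : ℂ) * Complex.I) := by
  refine integrable_meijerIntegrand_of_neg ?_
  simp only [meijerIntegrand_full]
  have hσ : 0 < -c := by linarith
  have h0 : |(0 : ℝ)| < Real.pi / 2 := by rw [abs_zero]; positivity
  have hΓ := integrable_cexp_mul_Gamma_vertical h0 hσ
  simp only [Complex.ofReal_zero, zero_mul, neg_zero, Complex.exp_zero, one_mul] at hΓ
  have hxc : (x : ℂ) ≠ 0 := Complex.ofReal_ne_zero.2 hx.ne'
  have hN : ∃ C : ℝ, ∀ y : ℝ,
      ‖Complex.Gamma (1 / 2 + (((-c : ℝ) : ℂ) + y * Complex.I)) ^ N‖ ≤ C := by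
    obtain ⟨C, hC⟩ := exists_norm_Gamma_mul_exp_mul_pow_le h0 0 (σ := 1 / 2 + -c) (by linarith)
    refine ⟨C ^ N, fun y => ?_⟩
    rw [norm_pow]
    refine pow_le_pow_left₀ (norm_nonneg _) ?_ N
    have := hC y
    simp only [zero_mul, Real.exp_zero, mul_one, pow_zero] at this
    rwa [show (((1 / 2 + -c : ℝ) : ℂ) + y * Complex.I) =
      1 / 2 + (((-c : ℝ) : ℂ) + y * Complex.I) by push_cast; ring] at this
  have hn : ∃ C : ℝ, ∀ y : ℝ,
      ‖Complex.Gamma (1 / 2 - (((-c : ℝ) : ℂ) + y * Complex.I)) ^ n‖ ≤ C := by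
    -- For `n = 0` the real part `1/2 + c` may be nonpositive, but the factor is then an empty
    -- power.
    rcases eq_or_ne n 0 with rfl | hn
    · exact ⟨1, fun y => by simp⟩
    obtain ⟨C, hC⟩ := exists_norm_Gamma_mul_exp_mul_pow_le h0 0 (σ := 1 / 2 + c)
      (by linarith [hcn hn])
    refine ⟨C ^ n, fun y => ?_⟩
    rw [norm_pow]
    refine pow_le_pow_left₀ (norm_nonneg _) ?_ n
    have := hC (-y)
    simp only [zero_mul, Real.exp_zero, mul_one, pow_zero] at this
    rwa [show (((1 / 2 + c : ℝ) : ℂ) + (-y : ℝ) * Complex.I) =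
      1 / 2 - (((-c : ℝ) : ℂ) + y * Complex.I) by push_cast; ring] at this
  have hNc : Continuous fun y : ℝ =>
      Complex.Gamma (1 / 2 + (((-c : ℝ) : ℂ) + y * Complex.I)) ^ N := by
    refine Continuous.pow ?_ N
    convert continuous_Gamma_vertical (σ := 1 / 2 + -c) (by linarith) using 3
    push_cast; ring
  have hnc : Continuous fun y : ℝ =>
      Complex.Gamma (1 / 2 - (((-c : ℝ) : ℂ) + y * Complex.I)) ^ n := by
    rcases eq_or_ne n 0 with rfl | hn
    · simpa using continuous_const
    refine Continuous.pow ?_ n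
    convert (continuous_Gamma_vertical (σ := 1 / 2 + c) (by linarith [hcn hn])).comp
      continuous_neg using 3
    simp only [Function.comp]
    congr 1
    push_cast; ring
  obtain ⟨A, hA⟩ := hN
  obtain ⟨B, hB⟩ := hn
  refine ((hΓ.mul_bdd hNc.aestronglyMeasurable (Eventually.of_forall hA)).mul_bdd
    hnc.aestronglyMeasurable (Eventually.of_forall hB)).mul_bdd (c := x ^ (-(-c)))
    (Continuous.aestronglyMeasurable ?_) (Eventually.of_forall fun y => ?_)
  · exact Continuous.const_cpow (by fun_prop) (Or.inl hxc)
  · exact (norm_ofReal_cpow_neg_vertical hx _ _).le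

/-! ### At least one variable in the numerator -/

section

variable {Ω : Type*} [MeasurableSpace Ω] {μ : Measure Ω} [IsProbabilityMeasure μ]

theorem integral_cexp_productRatio_eq_full {M N : ℕ} {X : Fin (M + 1) → Ω → ℝ}
    {Y : Fin N → Ω → ℝ} {σ : Fin (M + 1) → ℝ} {s : Fin N → ℝ}
    (hτ : ∀ i, 0 < Sum.elim σ s i)
    (hV : ∀ i, HasLaw (Sum.elim X Y i) (gaussianReal 0 (Real.toNNReal (Sum.elim σ s i ^ 2))) μ)
    (hindep : iIndepFun (Sum.elim X Y) μ) {c : ℝ} (hc : c < 0) (hcM : M ≠ 0 → -1 / 2 < c)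
    {t : ℝ} (ht : 0 < t) :
    ∫ ω, Complex.exp (Complex.I * t * (productRatio X Y ω : ℂ)) ∂μ =
      ((1 / √Real.pi ^ (N + M) : ℝ) : ℂ) *
        meijerLineIntegral (N + 1) M (fun _ : Fin M => (1 / 2 : ℂ))
          (Matrix.vecCons (0 : ℂ) (fun _ : Fin N => (1 / 2 : ℂ))) c
          (2 ^ (M + 1) * (∏ i, σ i) ^ 2 / (2 ^ (N + 2) * (∏ j, s j) ^ 2) * t ^ 2) := by
  have hσ : 0 < -c := by linarith
  have hm := fun i => (hV i).aemeasurable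
  set i₀ : Fin (M + 1) ⊕ Fin N := Sum.inl 0 with hi₀
  set S := Finset.univ.erase i₀ with hS
  set R : Ω → ℝ := fun ω => ∏ i ∈ S, ratioFactor X Y i ω with hR
  have hRm : AEMeasurable R μ :=
    Finset.aemeasurable_fun_prod _ fun i _ => aemeasurable_ratioFactor hm i
  have hR0 : ∀ᵐ ω ∂μ, R ω ≠ 0 :=
    ae_prod_ratioFactor_ne_zero (fun i => toNNReal_sq_ne_zero (hτ i)) hV S
  have hσ0 : 0 < σ 0 := hτ (Sum.inl 0)
  have hx₀ : 0 < t ^ 2 * σ 0 ^ 2 / 2 := by positivity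
  -- The exponents for which `(R²)^(-w) = |R|^(-2w)` is a product over all variables, the
  -- conditioned one with exponent `0`.
  set z : ℂ → Fin (M + 1) ⊕ Fin N → ℂ :=
    fun w i => if i ∈ S then ratioSign i * (2 * -w) else 0 with hz
  have hzre : ∀ (y : ℝ) i, -1 < (z (((-c : ℝ) : ℂ) + y * Complex.I) i).re := by
    intro y i
    simp only [hz]
    split_ifs with hi
    · rcases i with i | j
      -- A numerator variable left in `S` forces `M ≠ 0`; its moment condition `-1 < 2c` is then the
      -- separation condition.
      · have hM : M ≠ 0 := by
          rintro rfl
          exact Finset.ne_of_mem_erase hi (congrArg Sum.inl (Fin.ext (by omega)))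
        have := hcM hM
        simp [ratioSign]
        linarith
      · simp [ratioSign]
        linarith
    · simp
  have hWz : ∀ w : ℂ, ∀ᵐ ω ∂μ, ((R ω ^ 2 : ℝ) : ℂ) ^ (-w) =
      ∏ i, ((|Sum.elim X Y i ω| : ℝ) : ℂ) ^ z w i := fun w => by
    filter_upwards [hR0] with ω hω
    rw [ofReal_sq_cpow hω]
    exact abs_prod_ratioFactor_cpow S ω _
  have hWpos : ∀ᵐ ω ∂μ, 0 < R ω ^ 2 := by
    filter_upwards [hR0] with ω hω
    positivity
  have hint : Integrable (fun ω => (R ω ^ 2) ^ (-(-c))) μ := by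
    refine integrable_rpow_of_cpow hWpos ?_
    exact (integrable_prod_abs_cpow hτ hV hindep (hzre 0)).congr
      ((hWz _).mono fun ω h => h.symm)
  have h0 : |(0 : ℝ)| < Real.pi / 2 := by rw [abs_zero]; positivity
  have hΓ := integrable_cexp_mul_Gamma_vertical h0 hσ
  simp only [Complex.ofReal_zero, zero_mul, neg_zero, Complex.exp_zero, one_mul] at hΓ
  have hexp : ∀ u : ℝ, 0 < u → Complex.exp (-(u : ℂ)) = 1 / (2 * Real.pi) * ∫ y : ℝ,
      Complex.Gamma (((-c : ℝ) : ℂ) + y * Complex.I) *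
        (u : ℂ) ^ (-(((-c : ℝ) : ℂ) + y * Complex.I)) := fun u hu => by
    have := cexp_neg_eq_integral_Gamma h0 hσ hu
    simpa only [Complex.ofReal_zero, zero_mul, neg_zero, Complex.exp_zero, one_mul, neg_mul]
      using this
  have hmain := integral_comp_mellinInv (hRm.pow_const 2) hWpos hΓ
    (g := fun u => Complex.exp (-(u : ℂ))) hexp hint hx₀
  have hφ : ∫ ω, Complex.exp (Complex.I * t * (productRatio X Y ω : ℂ)) ∂μ =
      ∫ ω, Complex.exp (-((t ^ 2 * σ 0 ^ 2 / 2 * R ω ^ 2 : ℝ) : ℂ)) ∂μ := by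
    have := integral_cexp_mul_gaussian (hV i₀) hRm (indepFun_ratioFactor hm hindep i₀) t
    rw [Real.coe_toNNReal _ (sq_nonneg _)] at this
    rw [← show Sum.elim σ s i₀ = σ 0 from rfl, ← this]
    simp only [productRatio_eq_mul i₀]
    rfl
  rw [hφ, hmain, meijerLineIntegral_eq]
  rw [mul_left_comm, ← integral_const_mul (((1 / √Real.pi ^ (N + M) : ℝ) : ℂ))]
  congr 1
  refine integral_congr_ae (Eventually.of_forall fun y => ?_)
  simp only
  set w : ℂ := ((-c : ℝ) : ℂ) + y * Complex.I with hw
  rw [meijerIntegrand_full, integral_congr_ae (hWz w),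
    integral_prod_abs_cpow (z := z w) hτ hV hindep (hzre y)]
  have hsp : ((√Real.pi : ℝ) : ℂ) ≠ 0 :=
    Complex.ofReal_ne_zero.2 (Real.sqrt_pos.2 Real.pi_pos).ne'
  have hz0 : z w (Sum.inl 0) = 0 := by simp [hz, hS, hi₀]
  have hz1 : ∀ i : Fin M, z w (Sum.inl i.succ) = -(2 * w) := fun i => by
    simp [hz, hS, hi₀, ratioSign]
  have hz2 : ∀ j : Fin N, z w (Sum.inr j) = 2 * w := fun j => by
    simp [hz, hS, hi₀, ratioSign]
  rw [Fintype.prod_sum_type, Fin.prod_univ_succ]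
  simp only [Sum.elim_inl, Sum.elim_inr, hz0, hz1, hz2]
  -- The conditioned variable contributes `Γ(1/2) / √π = 1`.
  have e1 : ((0 : ℂ) + 1) / 2 = 1 / 2 := by norm_num
  have e2 : (-(2 * w) + 1) / 2 = 1 / 2 - w := by ring
  have e3 : (2 * w + 1) / 2 = 1 / 2 + w := by ring
  have e4 : -(2 * w) / 2 = -w := by ring
  have e5 : 2 * w / 2 = w := by ring
  have e6 : Complex.Gamma (1 / 2) = ((√Real.pi : ℝ) : ℂ) := by
    rw [Complex.Gamma_one_half_eq, Real.sqrt_eq_rpow, Complex.ofReal_cpow Real.pi_pos.le]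
    norm_num
  rw [e1, e2, e3, e4, e5, e6, zero_div, Complex.cpow_zero, one_mul, div_self hsp, one_mul]
  have hσi : ∀ i, 0 < σ i := fun i => hτ (Sum.inl i)
  have hsj : ∀ j, 0 < s j := fun j => hτ (Sum.inr j)
  -- The argument splits into the conditional variance term and one factor `2τ²`, or its inverse,
  -- per remaining variable, as in the moment formula.
  have hxeq : (2 ^ (M + 1) * (∏ i, σ i) ^ 2 / (2 ^ (N + 2) * (∏ j, s j) ^ 2) * t ^ 2 : ℝ) =
      t ^ 2 * σ 0 ^ 2 / 2 * ((∏ i : Fin M, 2 * σ i.succ ^ 2) * (∏ j, 2 * s j ^ 2)⁻¹) := by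
    have : ∏ j, s j ≠ 0 := (Finset.prod_pos fun j _ => hsj j).ne'
    rw [Fin.prod_univ_succ, Finset.prod_mul_distrib, Finset.prod_mul_distrib, Finset.prod_pow,
      Finset.prod_pow]
    simp only [Finset.prod_const, Finset.card_univ, Fintype.card_fin]
    field_simp
    ring
  have hA : ∀ i : Fin M, 0 ≤ 2 * σ i.succ ^ 2 := fun i => by positivity
  have hB : ∀ j, 0 ≤ 2 * s j ^ 2 := fun j => by positivity
  have hpA : 0 ≤ ∏ i : Fin M, 2 * σ i.succ ^ 2 := Finset.prod_nonneg fun i _ => hA i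
  have hpB : 0 ≤ ∏ j, 2 * s j ^ 2 := Finset.prod_nonneg fun j _ => hB j
  rw [hxeq, Complex.ofReal_mul (t ^ 2 * σ 0 ^ 2 / 2), Complex.mul_cpow_ofReal_nonneg hx₀.le
    (mul_nonneg hpA (inv_nonneg.2 hpB)), Complex.ofReal_mul (∏ i : Fin M, 2 * σ i.succ ^ 2),
    Complex.mul_cpow_ofReal_nonneg hpA (inv_nonneg.2 hpB), ofReal_inv_cpow hpB, neg_neg,
    ofReal_prod_cpow _ fun i _ => hA i, ofReal_prod_cpow _ fun i _ => hB i]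
  simp only [Finset.prod_div_distrib, Finset.prod_mul_distrib, Finset.prod_const,
    Finset.card_univ, Fintype.card_fin]
  have e7 : ((1 / √Real.pi ^ (N + M) : ℝ) : ℂ) = 1 / ((√Real.pi : ℝ) : ℂ) ^ (N + M) := by
    push_cast; rfl
  rw [e7, pow_add]
  generalize ((t ^ 2 * σ 0 ^ 2 / 2 : ℝ) : ℂ) ^ (-w) = T
  field_simp

end

/-! ### No variable in the numerator -/

/-- Duplication and reflection combined. -/
theorem two_mul_Gamma_two_mul_mul_cos {w : ℂ} (hw : 0 < w.re) :
    2 * (Complex.Gamma (2 * w) * Complex.cos (Real.pi * w)) =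
      ((√Real.pi : ℝ) : ℂ) * (4 : ℂ) ^ w * (Complex.Gamma w / Complex.Gamma (1 / 2 - w)) := by
  -- The functional-equation identity `Γ_ℝ(s) / Γ_ℝ(1-s) = Γ_ℂ(s) cos(πs/2)` at `s = 2w` contains
  -- both formulas.
  have h := Complex.Gammaℝ_div_Gammaℝ_one_sub (s := 2 * w) fun n hn => by
    have := congrArg Complex.re hn
    simp at this
    have h2 : (0 : ℝ) ≤ n := n.cast_nonneg
    linarith
  have hπ : (Real.pi : ℂ) ≠ 0 := Complex.ofReal_ne_zero.2 Real.pi_ne_zero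
  rw [Complex.Gammaℝ_def, Complex.Gammaℝ_def, Complex.Gammaℂ_def] at h
  have e1 : -(2 * w) / 2 = -w := by ring
  have e2 : 2 * w / 2 = w := by ring
  have e3 : -(1 - 2 * w) / 2 = w - 1 / 2 := by ring
  have e4 : (1 - 2 * w) / 2 = 1 / 2 - w := by ring
  have e5 : (Real.pi : ℂ) * (2 * w) / 2 = Real.pi * w := by ring
  have e6 : (2 * (Real.pi : ℂ)) ^ (-(2 * w)) = ((4 : ℂ) ^ w)⁻¹ * ((Real.pi : ℂ) ^ (2 * w))⁻¹ := by
    have h4 : (4 : ℂ) ^ w = (2 : ℂ) ^ (2 * w) := by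
      have := ofReal_sq_cpow (r := 2) (by norm_num) w
      norm_num at this
      exact this
    have := Complex.mul_cpow_ofReal_nonneg (a := 2) (b := Real.pi) (by norm_num)
      Real.pi_pos.le (-(2 * w))
    rw [h4, ← Complex.cpow_neg, ← Complex.cpow_neg]
    simpa using this
  have e7 : ((√Real.pi : ℝ) : ℂ) = (Real.pi : ℂ) ^ (1 / 2 : ℂ) := by
    rw [Real.sqrt_eq_rpow, Complex.ofReal_cpow Real.pi_pos.le]
    norm_num
  have h4 : (4 : ℂ) ^ w ≠ 0 := by simp [Complex.cpow_eq_zero_iff]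
  have hp : (Real.pi : ℂ) ^ w ≠ 0 := by simp [Complex.cpow_eq_zero_iff, hπ]
  have hp2 : (Real.pi : ℂ) ^ (1 / 2 : ℂ) ≠ 0 := by simp [Complex.cpow_eq_zero_iff, hπ]
  rw [e1, e2, e3, e4, e5, e6, two_mul w, Complex.cpow_add _ _ hπ, Complex.cpow_sub _ _ hπ,
    Complex.cpow_neg, ← two_mul w] at h
  rw [e7]
  have h' : Complex.Gamma w / Complex.Gamma (1 / 2 - w) =
      ((Real.pi : ℂ) ^ w * ((Real.pi : ℂ) ^ w / (Real.pi : ℂ) ^ (1 / 2 : ℂ))) *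
        (((Real.pi : ℂ) ^ w)⁻¹ * Complex.Gamma w /
          ((Real.pi : ℂ) ^ w / (Real.pi : ℂ) ^ (1 / 2 : ℂ) * Complex.Gamma (1 / 2 - w))) := by
    -- `D = 0` is the default value of `Complex.Gamma` at its poles; both sides then vanish.
    generalize Complex.Gamma (1 / 2 - w) = D
    rcases eq_or_ne D 0 with rfl | hD
    · simp
    · field_simp
  rw [h', h]
  field_simp

/-- One factor carries the polynomial weight and the others are merely bounded; an index `i₀` is
needed because an empty product does not decay. -/
theorem exists_norm_prod_mul_pow_le {ι : Type*} [Fintype ι] [DecidableEq ι] (i₀ : ι)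
    {f : ι → ℝ → ℂ} (hf : ∀ i (n : ℕ), ∃ C : ℝ, ∀ y, ‖f i y‖ * (1 + |y|) ^ n ≤ C) (n : ℕ) :
    ∃ C : ℝ, ∀ y, ‖∏ i, f i y‖ * (1 + |y|) ^ n ≤ C := by
  choose C hC using hf
  refine ⟨C i₀ n * ∏ i ∈ Finset.univ.erase i₀, C i 0, fun y => ?_⟩
  rw [← Finset.mul_prod_erase _ (fun i => f i y) (Finset.mem_univ i₀), norm_mul, norm_prod,
    mul_right_comm]
  refine mul_le_mul (hC i₀ n y) (Finset.prod_le_prod (fun i _ => norm_nonneg _) fun i _ => ?_)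
    (Finset.prod_nonneg fun i _ => norm_nonneg _) (le_trans (by positivity) (hC i₀ n y))
  simpa using hC i 0 y

theorem exists_norm_cpow_mul_Gamma_half_mul_pow_le {v : ℝ} (hv : 0 < v) {σ : ℝ} (hσ : 0 < σ)
    (n : ℕ) : ∃ C : ℝ, ∀ y : ℝ, ‖(v : ℂ) ^ ((σ + y * Complex.I) / 2) *
      Complex.Gamma ((σ + y * Complex.I + 1) / 2) / (√Real.pi : ℝ)‖ * (1 + |y|) ^ n ≤ C := by
  have h0 : |(0 : ℝ)| < Real.pi / 2 := by rw [abs_zero]; positivity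
  obtain ⟨C, hC⟩ := exists_norm_Gamma_mul_exp_mul_pow_le h0 n (σ := (σ + 1) / 2) (by linarith)
  refine ⟨v ^ (σ / 2) / √Real.pi * 2 ^ n * C, fun y => ?_⟩
  have h1 := hC (y / 2)
  rw [zero_mul, Real.exp_zero, mul_one, show (((σ + 1) / 2 : ℝ) : ℂ) + (y / 2 : ℝ) * Complex.I =
    (σ + y * Complex.I + 1) / 2 by push_cast; ring] at h1
  have h2 : ‖(v : ℂ) ^ ((σ + y * Complex.I) / 2)‖ = v ^ (σ / 2) := by
    rw [Complex.norm_cpow_eq_rpow_re_of_pos hv]; simp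
  rw [norm_div, norm_mul, h2, Complex.norm_real, Real.norm_of_nonneg (Real.sqrt_nonneg _)]
  have h3 : (1 + |y|) ^ n ≤ 2 ^ n * (1 + |y / 2|) ^ n := by
    rw [← mul_pow]
    gcongr
    rw [abs_div, abs_two]
    linarith
  calc _ = v ^ (σ / 2) / √Real.pi * (‖Complex.Gamma ((σ + y * Complex.I + 1) / 2)‖ *
        (1 + |y|) ^ n) := by ring
    _ ≤ v ^ (σ / 2) / √Real.pi * (‖Complex.Gamma ((σ + y * Complex.I + 1) / 2)‖ *
        (2 ^ n * (1 + |y / 2|) ^ n)) := by gcongr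
    _ = v ^ (σ / 2) / √Real.pi * 2 ^ n * (‖Complex.Gamma ((σ + y * Complex.I + 1) / 2)‖ *
        (1 + |y / 2|) ^ n) := by ring
    _ ≤ _ := by gcongr

theorem continuous_cpow_mul_Gamma_half {v : ℝ} (hv : 0 < v) {σ : ℝ} (hσ : 0 < σ) :
    Continuous fun y : ℝ => (v : ℂ) ^ ((σ + y * Complex.I) / 2) *
      Complex.Gamma ((σ + y * Complex.I + 1) / 2) / (√Real.pi : ℝ) := by
  refine (Continuous.mul (Continuous.const_cpow (by fun_prop)
    (Or.inl (Complex.ofReal_ne_zero.2 hv.ne'))) ?_).div_const _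
  have h := (continuous_Gamma_vertical (σ := (σ + 1) / 2) (by linarith)).comp
    (continuous_id.div_const (2 : ℝ))
  convert h using 2
  simp only [Function.comp, id]
  congr 1
  push_cast
  ring

section

variable {Ω : Type*} [MeasurableSpace Ω] {μ : Measure Ω} [IsProbabilityMeasure μ]

/-- The average of the limit cases `θ = ±π/2`, in which `exp(-e^(iθ)u)` is `e^(∓iu)`. -/
theorem integral_cos_mul_eq {W : Ω → ℝ} (hW : AEMeasurable W μ)
    (hpos : ∀ᵐ ω ∂μ, 0 < W ω) {σ : ℝ} (hσ : 0 < σ)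
    (hint : Integrable (fun ω => W ω ^ (-σ)) μ) {H : ℝ → ℂ} (hHc : Continuous H)
    (hH : ∀ y : ℝ, ∫ ω, (W ω : ℂ) ^ (-(σ + y * Complex.I)) ∂μ = H y)
    (hHd : ∀ n : ℕ, ∃ C : ℝ, ∀ y, ‖H y‖ * (1 + |y|) ^ n ≤ C) {x : ℝ} (hx : 0 < x) :
    Integrable (fun y : ℝ => (Complex.Gamma (σ + y * Complex.I) *
        Complex.cos (Real.pi / 2 * (σ + y * Complex.I))) *
        ((x : ℂ) ^ (-(σ + y * Complex.I)) * H y)) ∧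
    ∫ ω, Complex.cos ((x * W ω : ℝ) : ℂ) ∂μ =
      1 / (2 * Real.pi) * ∫ y : ℝ, (Complex.Gamma (σ + y * Complex.I) *
        Complex.cos (Real.pi / 2 * (σ + y * Complex.I))) *
        ((x : ℂ) ^ (-(σ + y * Complex.I)) * H y) := by
  have hpi : 0 ≤ Real.pi / 2 := by positivity
  obtain ⟨i1, h1⟩ := integral_cexp_neg_rotated hW hpos hσ hint hHc hH hHd
    (θ := Real.pi / 2) (abs_of_nonneg hpi).le hx
  obtain ⟨i2, h2⟩ := integral_cexp_neg_rotated hW hpos hσ hint hHc hH hHd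
    (θ := -(Real.pi / 2)) (by rw [abs_neg, abs_of_nonneg hpi]) hx
  have hadd : ∀ y : ℝ, (Complex.Gamma (σ + y * Complex.I) *
        Complex.cos (Real.pi / 2 * (σ + y * Complex.I))) *
        ((x : ℂ) ^ (-(σ + y * Complex.I)) * H y) =
      1 / 2 * ((Complex.exp (-((Real.pi / 2 : ℝ) * Complex.I * (σ + y * Complex.I))) *
        Complex.Gamma (σ + y * Complex.I)) * ((x : ℂ) ^ (-(σ + y * Complex.I)) * H y) +
        (Complex.exp (-((-(Real.pi / 2) : ℝ) * Complex.I * (σ + y * Complex.I))) *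
        Complex.Gamma (σ + y * Complex.I)) * ((x : ℂ) ^ (-(σ + y * Complex.I)) * H y)) := by
    intro y
    rw [Complex.cos,
      show Real.pi / 2 * (σ + y * Complex.I) * Complex.I =
        -((-(Real.pi / 2) : ℝ) * Complex.I * (σ + y * Complex.I)) by push_cast; ring,
      show -(Real.pi / 2 * (σ + y * Complex.I)) * Complex.I =
        -((Real.pi / 2 : ℝ) * Complex.I * (σ + y * Complex.I)) by push_cast; ring]
    ring
  have hexp1 : Complex.exp ((Real.pi / 2 : ℝ) * Complex.I) = Complex.I := by
    push_cast; exact Complex.exp_pi_div_two_mul_I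
  have hexp2 : Complex.exp ((-(Real.pi / 2) : ℝ) * Complex.I) = -Complex.I := by
    push_cast; rw [← neg_div]; exact Complex.exp_neg_pi_div_two_mul_I
  rw [hexp1] at h1
  rw [hexp2, neg_neg] at h2
  simp only [hadd]
  refine ⟨(i1.add i2).const_mul _, ?_⟩
  rw [integral_const_mul, integral_add i1 i2, mul_left_comm, mul_add, ← h1, ← h2,
    ← integral_add, ← integral_const_mul]
  · refine integral_congr_ae (Eventually.of_forall fun ω => ?_)
    simp only
    rw [Complex.cos, mul_comm _ Complex.I, mul_comm _ Complex.I, neg_mul, mul_neg]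
    ring
  all_goals
    refine (integrable_const (1 : ℝ)).mono' (AEMeasurable.aestronglyMeasurable (by fun_prop))
      (Eventually.of_forall fun ω => ?_)
    simp [Complex.norm_exp]

/-- Passing to `|Z|` makes the variable nonnegative, as the Mellin argument requires. -/
theorem integral_cexp_eq_integral_cos_abs {Z : Ω → ℝ} (hZ : AEMeasurable Z μ) {t : ℝ}
    (h : ∫ ω, Complex.exp (Complex.I * t * (Z ω : ℂ)) ∂μ =
      ∫ ω, Complex.exp (-(Complex.I * t * (Z ω : ℂ))) ∂μ) :
    ∫ ω, Complex.exp (Complex.I * t * (Z ω : ℂ)) ∂μ =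
      ∫ ω, Complex.cos ((t * |Z ω| : ℝ) : ℂ) ∂μ := by
  have i1 : Integrable (fun ω => Complex.exp (Complex.I * t * (Z ω : ℂ))) μ := by
    refine (integrable_const (1 : ℝ)).mono' (AEMeasurable.aestronglyMeasurable (by fun_prop))
      (Eventually.of_forall fun ω => ?_)
    simp [Complex.norm_exp]
  have i2 : Integrable (fun ω => Complex.exp (-(Complex.I * t * (Z ω : ℂ)))) μ := by
    refine (integrable_const (1 : ℝ)).mono' (AEMeasurable.aestronglyMeasurable (by fun_prop))
      (Eventually.of_forall fun ω => ?_)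
    simp [Complex.norm_exp]
  have hcos : ∀ ω, Complex.cos ((t * |Z ω| : ℝ) : ℂ) = 1 / 2 *
      (Complex.exp (Complex.I * t * (Z ω : ℂ)) + Complex.exp (-(Complex.I * t * (Z ω : ℂ)))) := by
    intro ω
    have : Complex.cos ((t * |Z ω| : ℝ) : ℂ) = Complex.cos ((t * Z ω : ℝ) : ℂ) := by
      rcases abs_choice (Z ω) with h | h
      · rw [h]
      · rw [h, mul_neg, Complex.ofReal_neg, Complex.cos_neg]
    rw [this, Complex.cos,
      show ((t * Z ω : ℝ) : ℂ) * Complex.I = Complex.I * t * (Z ω : ℂ) by push_cast; ring,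
      show -((t * Z ω : ℝ) : ℂ) * Complex.I = -(Complex.I * t * (Z ω : ℂ)) by push_cast; ring]
    ring
  simp only [hcos]
  rw [integral_const_mul, integral_add i1 i2, ← h]
  ring

theorem integral_cexp_productRatio_eq_drop_last {N : ℕ} {X : Fin 0 → Ω → ℝ}
    {Y : Fin N → Ω → ℝ} {σ : Fin 0 → ℝ} {s : Fin N → ℝ} (hN : 0 < N)
    (hτ : ∀ i, 0 < Sum.elim σ s i)
    (hV : ∀ i, HasLaw (Sum.elim X Y i) (gaussianReal 0 (Real.toNNReal (Sum.elim σ s i ^ 2))) μ)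
    (hindep : iIndepFun (Sum.elim X Y) μ) {c : ℝ} (hc : c < 0) {t : ℝ} (ht : 0 < t) :
    Integrable (fun y : ℝ => meijerIntegrand (N + 1) 0 (Fin.elim0 : Fin 0 → ℂ)
      (Matrix.vecCons (0 : ℂ) (fun _ : Fin (N + 1) => (1 / 2 : ℂ)))
      (1 / (2 ^ (N + 2) * (∏ j, s j) ^ 2) * t ^ 2) ((c : ℂ) + (y : ℂ) * Complex.I)) ∧
    ∫ ω, Complex.exp (Complex.I * t * (productRatio X Y ω : ℂ)) ∂μ =
      ((√Real.pi / √Real.pi ^ N : ℝ) : ℂ) *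
        meijerLineIntegral (N + 1) 0 (Fin.elim0 : Fin 0 → ℂ)
          (Matrix.vecCons (0 : ℂ) (fun _ : Fin (N + 1) => (1 / 2 : ℂ))) c
          (1 / (2 ^ (N + 2) * (∏ j, s j) ^ 2) * t ^ 2) := by
  -- The Mellin variable of the cosine is `2w` with `Re w = -c`, hence the doubled abscissa.
  have hσ : 0 < 2 * -c := by linarith
  have hm := fun i => (hV i).aemeasurable
  have hsj : ∀ j, 0 < s j := fun j => hτ (Sum.inr j)
  have hZm := aemeasurable_productRatio hm
  set W : Ω → ℝ := fun ω => |productRatio X Y ω| with hW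
  have hWm : AEMeasurable W μ := by
    have := hZm.norm
    exact this
  have hWpos : ∀ᵐ ω ∂μ, 0 < W ω := by
    filter_upwards [ae_prod_ratioFactor_ne_zero (fun i => toNNReal_sq_ne_zero (hτ i)) hV
      Finset.univ] with ω hω
    rw [← productRatio_eq_prod_ratioFactor] at hω
    exact abs_pos.2 hω
  set z : ℝ → Fin 0 ⊕ Fin N → ℂ :=
    fun y i => ratioSign i * (-(((2 * -c : ℝ) : ℂ) + y * Complex.I)) with hz
  have hzre : ∀ (y : ℝ) i, -1 < (z y i).re := by
    intro y i
    rcases i with i | j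
    · exact i.elim0
    · simp [hz, ratioSign]
      linarith
  have hWz : ∀ y : ℝ, ∀ ω, (W ω : ℂ) ^ (-(((2 * -c : ℝ) : ℂ) + y * Complex.I)) =
      ∏ i, ((|Sum.elim X Y i ω| : ℝ) : ℂ) ^ z y i := fun y ω => by
    simp only [hW, productRatio_eq_prod_ratioFactor, abs_prod_ratioFactor_cpow, hz,
      Finset.mem_univ, if_true]
  have hint : Integrable (fun ω => W ω ^ (-(2 * -c))) μ := by
    refine integrable_rpow_of_cpow hWpos ?_
    exact (integrable_prod_abs_cpow hτ hV hindep (hzre 0)).congr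
      (Eventually.of_forall fun ω => (hWz 0 ω).symm)
  set h : Fin N → ℝ → ℂ := fun j y => ((2 * s j ^ 2 : ℝ) : ℂ) ^
    ((((2 * -c : ℝ) : ℂ) + y * Complex.I) / 2) *
      Complex.Gamma ((((2 * -c : ℝ) : ℂ) + y * Complex.I + 1) / 2) / (√Real.pi : ℝ) with hh
  have hpj : ∀ j, 0 < 2 * s j ^ 2 := fun j => by have := hsj j; positivity
  have hH : ∀ y : ℝ, ∫ ω, (W ω : ℂ) ^ (-(((2 * -c : ℝ) : ℂ) + y * Complex.I)) ∂μ =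
      ∏ j, h j y := fun y => by
    simp only [hWz]
    rw [integral_prod_abs_cpow hτ hV hindep (hzre y), Fintype.prod_sum_type, Fin.prod_univ_zero,
      one_mul]
    refine Finset.prod_congr rfl fun j _ => ?_
    simp only [hz, hh, ratioSign, Sum.elim_inr, neg_mul, one_mul, neg_neg]
  obtain ⟨hi, hφ⟩ := integral_cos_mul_eq hWm hWpos hσ hint (H := fun y => ∏ j, h j y)
    (continuous_finsetProd _ fun j _ => continuous_cpow_mul_Gamma_half (hpj j) hσ) hH
    (exists_norm_prod_mul_pow_le ⟨0, hN⟩ fun j n =>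
      exists_norm_cpow_mul_Gamma_half_mul_pow_le (hpj j) hσ n) ht
  set K : ℝ → ℂ := fun y => (Complex.Gamma (((2 * -c : ℝ) : ℂ) + y * Complex.I) *
        Complex.cos (Real.pi / 2 * (((2 * -c : ℝ) : ℂ) + y * Complex.I))) *
        ((t : ℂ) ^ (-(((2 * -c : ℝ) : ℂ) + y * Complex.I)) * ∏ j, h j y) with hK
  have hsp : ((√Real.pi : ℝ) : ℂ) ≠ 0 :=
    Complex.ofReal_ne_zero.2 (Real.sqrt_pos.2 Real.pi_pos).ne'
  have hCne : ((√Real.pi / √Real.pi ^ N : ℝ) : ℂ) ≠ 0 :=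
    Complex.ofReal_ne_zero.2 (div_pos (Real.sqrt_pos.2 Real.pi_pos)
      (pow_pos (Real.sqrt_pos.2 Real.pi_pos) _)).ne'
  -- The leading `2` is the Jacobian of `y ↦ 2y`; it also supplies the `2` in the duplication
  -- identity.
  have key : ∀ y : ℝ, 2 * K (2 * y) = ((√Real.pi / √Real.pi ^ N : ℝ) : ℂ) *
      meijerIntegrand (N + 1) 0 (Fin.elim0 : Fin 0 → ℂ)
        (Matrix.vecCons (0 : ℂ) (fun _ : Fin (N + 1) => (1 / 2 : ℂ)))
        (1 / (2 ^ (N + 2) * (∏ j, s j) ^ 2) * t ^ 2) (-(((-c : ℝ) : ℂ) + y * Complex.I)) := by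
    intro y
    have e0 : ((2 * -c : ℝ) : ℂ) + (2 * y : ℝ) * Complex.I =
        2 * (((-c : ℝ) : ℂ) + y * Complex.I) := by push_cast; ring
    simp only [hK, hh, e0]
    have hwre : 0 < (((-c : ℝ) : ℂ) + y * Complex.I).re := by simpa using hc
    set w : ℂ := ((-c : ℝ) : ℂ) + y * Complex.I with hw
    have e1 : (Real.pi : ℂ) / 2 * (2 * w) = Real.pi * w := by ring
    have e2 : 2 * w / 2 = w := by ring
    have e3 : (2 * w + 1) / 2 = 1 / 2 + w := by ring
    have e4 : (t : ℂ) ^ (-(2 * w)) = ((t ^ 2 : ℝ) : ℂ) ^ (-w) := by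
      rw [ofReal_sq_cpow ht.ne', abs_of_pos ht, mul_neg]
    have hP : 0 ≤ ∏ j, 2 * s j ^ 2 := Finset.prod_nonneg fun j _ => (hpj j).le
    -- The factor `4⁻¹` in the argument accounts for the `4^w` from duplication.
    have hxeq : (1 / (2 ^ (N + 2) * (∏ j, s j) ^ 2) * t ^ 2 : ℝ) =
        4⁻¹ * ((∏ j, 2 * s j ^ 2)⁻¹ * t ^ 2) := by
      have : ∏ j, s j ≠ 0 := (Finset.prod_pos fun j _ => hsj j).ne'
      rw [Finset.prod_mul_distrib, Finset.prod_pow]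
      simp only [Finset.prod_const, Finset.card_univ, Fintype.card_fin]
      field_simp
      ring
    have e5 : ((4⁻¹ : ℝ) : ℂ) ^ (-w) = (4 : ℂ) ^ w := by
      rw [ofReal_inv_cpow (by norm_num), neg_neg]
      norm_num
    rw [e1, e2, e3, e4, meijerIntegrand_drop_last, hxeq, Complex.ofReal_mul 4⁻¹,
      Complex.mul_cpow_ofReal_nonneg (by norm_num)
        (mul_nonneg (inv_nonneg.2 hP) (sq_nonneg t)), Complex.ofReal_mul (∏ j, 2 * s j ^ 2)⁻¹,
      Complex.mul_cpow_ofReal_nonneg (inv_nonneg.2 hP) (sq_nonneg t), ofReal_inv_cpow hP,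
      neg_neg, ofReal_prod_cpow _ fun j _ => (hpj j).le, e5, ← mul_assoc,
      two_mul_Gamma_two_mul_mul_cos hwre]
    simp only [Finset.prod_div_distrib, Finset.prod_mul_distrib, Finset.prod_const,
      Finset.card_univ, Fintype.card_fin]
    have e7 : ((√Real.pi / √Real.pi ^ N : ℝ) : ℂ) =
        ((√Real.pi : ℝ) : ℂ) / ((√Real.pi : ℝ) : ℂ) ^ N := by push_cast; rfl
    rw [e7]
    ring
  constructor
  · refine integrable_meijerIntegrand_of_neg ?_
    have h2 : Integrable fun y : ℝ => 2 * K (2 * y) :=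
      (hi.comp_mul_left' (two_ne_zero)).const_mul 2
    refine (h2.const_mul ((√Real.pi / √Real.pi ^ N : ℝ) : ℂ)⁻¹).congr
      (Eventually.of_forall fun y => ?_)
    simp only
    rw [key, inv_mul_cancel_left₀ hCne]
  · rw [integral_cexp_eq_integral_cos_abs hZm
      (integral_cexp_productRatio_neg hV hindep (Sum.inr ⟨0, hN⟩) t), hφ, meijerLineIntegral_eq, mul_left_comm,
      ← integral_const_mul ((√Real.pi / √Real.pi ^ N : ℝ) : ℂ)]
    simp only [← key]
    rw [integral_const_mul, Measure.integral_comp_mul_left]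
    congr 1
    rw [Complex.real_smul]
    norm_num
    ring

end

/-! ### Assembly of the two cases -/

theorem theorem2p3 {Ω : Type*} [MeasurableSpace Ω] (μ : Measure Ω) [IsProbabilityMeasure μ]
    (M N : ℕ) (X : Fin M → Ω → ℝ) (Y : Fin N → Ω → ℝ) (σ : Fin M → ℝ) (s : Fin N → ℝ)
    (hσ : ∀ i, 0 < σ i) (hs : ∀ j, 0 < s j)
    (hX : ∀ i, HasLaw (X i) (gaussianReal 0 (Real.toNNReal (σ i ^ 2))) μ)
    (hY : ∀ j, HasLaw (Y j) (gaussianReal 0 (Real.toNNReal (s j ^ 2))) μ)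
    (hindep : iIndepFun (Sum.elim X Y) μ) :
    (1 ≤ M →
      MeijerGWellDefined (N + 1) (M - 1) (fun _ : Fin (M - 1) => (1 / 2 : ℂ))
        (Matrix.vecCons (0 : ℂ) (fun _ : Fin N => (1 / 2 : ℂ))) ∧
      ∀ t : ℝ,
        ∫ ω, Complex.exp (Complex.I * (t : ℂ) * (productRatio X Y ω : ℂ)) ∂μ =
          ((1 / Real.pi ^ (((N : ℝ) + (M : ℝ) - 1) / 2) : ℝ) : ℂ) *
            meijerG (N + 1) (M - 1) (fun _ : Fin (M - 1) => (1 / 2 : ℂ))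
              (Matrix.vecCons (0 : ℂ) (fun _ : Fin N => (1 / 2 : ℂ)))
              (2 ^ M * (∏ i, σ i) ^ 2 * t ^ 2 / (2 ^ (N + 2) * (∏ j, s j) ^ 2))) ∧
    (M = 0 → 1 ≤ N →
      MeijerGWellDefined (N + 1) 0 (Fin.elim0 : Fin 0 → ℂ)
        (Matrix.vecCons (0 : ℂ) (fun _ : Fin (N + 1) => (1 / 2 : ℂ))) ∧
      ∀ t : ℝ,
        ∫ ω, Complex.exp (Complex.I * (t : ℂ) * (productRatio X Y ω : ℂ)) ∂μ =
          ((1 / Real.pi ^ (((N : ℝ) - 1) / 2) : ℝ) : ℂ) *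
            meijerG (N + 1) 0 (Fin.elim0 : Fin 0 → ℂ)
              (Matrix.vecCons (0 : ℂ) (fun _ : Fin (N + 1) => (1 / 2 : ℂ)))
              (t ^ 2 / (2 ^ (N + 2) * (∏ j, s j) ^ 2))) := by
  have hτ : ∀ i, 0 < Sum.elim σ s i := Sum.forall.2 ⟨hσ, hs⟩
  have hV : ∀ i, HasLaw (Sum.elim X Y i)
      (gaussianReal 0 (Real.toNNReal (Sum.elim σ s i ^ 2))) μ := Sum.forall.2 ⟨hX, hY⟩
  have hcont := continuous_integral_cexp_mul (μ := μ)
    (aemeasurable_productRatio fun i => (hV i).aemeasurable)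
  have heven : ∀ (i₀ : Fin M ⊕ Fin N) (t : ℝ),
      ∫ ω, Complex.exp (Complex.I * ((-t : ℝ) : ℂ) * (productRatio X Y ω : ℂ)) ∂μ =
        ∫ ω, Complex.exp (Complex.I * (t : ℂ) * (productRatio X Y ω : ℂ)) ∂μ := fun i₀ t => by
    rw [integral_cexp_productRatio_neg hV hindep i₀ t]
    simp only [Complex.ofReal_neg, mul_neg, neg_mul]
  have hsp : 0 < ∏ j, s j := Finset.prod_pos fun j _ => hs j
  have hσp : 0 < ∏ i, σ i := Finset.prod_pos fun i _ => hσ i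
  have hπ := Real.sqrt_pos.2 Real.pi_pos
  constructor
  · intro hM
    obtain ⟨M, rfl⟩ : ∃ m, M = m + 1 := ⟨M - 1, by omega⟩
    have hC : 1 / Real.pi ^ (((N : ℝ) + ((M + 1 : ℕ) : ℝ) - 1) / 2) =
        1 / √Real.pi ^ (N + M) := by
      rw [sqrt_pi_pow]
      congr 3
      push_cast
      ring
    rw [hC]
    have key := meijerGWellDefined_of_eq_mul (m := N + 1) (n := M)
      (a := fun _ : Fin M => (1 / 2 : ℂ))
      (b := Matrix.vecCons (0 : ℂ) (fun _ : Fin N => (1 / 2 : ℂ)))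
      (C := ((1 / √Real.pi ^ (N + M) : ℝ) : ℂ))
      (Complex.ofReal_ne_zero.2 (by positivity))
      (κ := 2 ^ (M + 1) * (∏ i, σ i) ^ 2 / (2 ^ (N + 2) * (∏ j, s j) ^ 2)) (by positivity)
      hcont (heven (Sum.inl 0))
      -- A point of `(-1/2, 0)`, admissible whether or not there are upper parameters.
      ⟨-1 / 4, (meijerSeparates_full_iff M N _).2 ⟨by norm_num, fun _ => by norm_num⟩⟩
      fun c hc t ht => by
        obtain ⟨h1, h2⟩ := (meijerSeparates_full_iff M N c).1 hc
        exact ⟨integrable_meijerIntegrand_full N h1 h2 (by positivity),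
          integral_cexp_productRatio_eq_full hτ hV hindep h1 h2 ht⟩
    refine ⟨key.1, fun t => ?_⟩
    rw [mul_div_right_comm]
    exact key.2 t
  · rintro rfl hN
    -- Each of the `N` moments gives `1/√π`, and duplication gives back one `√π`.
    have hC : 1 / Real.pi ^ (((N : ℝ) - 1) / 2) = √Real.pi / √Real.pi ^ N := by
      rw [sqrt_pi_pow, sub_div, Real.rpow_sub Real.pi_pos, ← Real.sqrt_eq_rpow]
      field_simp
    rw [hC]
    have key := meijerGWellDefined_of_eq_mul (m := N + 1) (n := 0)
      (a := (Fin.elim0 : Fin 0 → ℂ))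
      (b := Matrix.vecCons (0 : ℂ) (fun _ : Fin (N + 1) => (1 / 2 : ℂ)))
      (C := ((√Real.pi / √Real.pi ^ N : ℝ) : ℂ))
      (Complex.ofReal_ne_zero.2 (by positivity))
      (κ := 1 / (2 ^ (N + 2) * (∏ j, s j) ^ 2)) (by positivity)
      hcont (heven (Sum.inr ⟨0, hN⟩))
      ⟨-1, (meijerSeparates_drop_last_iff N _).2 (by norm_num)⟩
      fun c hc t ht => integral_cexp_productRatio_eq_drop_last hN hτ hV hindep
        ((meijerSeparates_drop_last_iff N c).1 hc) ht
    refine ⟨key.1, fun t => ?_⟩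
    have h := key.2 t
    rw [one_div_mul_eq_div] at h
    exact h
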